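/- **Setting.** For $N\ge 1$, a sequence is a triple $(X,E,M)$ of token features $X=(x_i)\in\mathbb R^{N\times C}$, positional encodings $E=(e_i)$ with $e_i\in\mathbb R^{K\times R}$, and a mask $M\in\{0,1\}^{N\times N}$. A *TAPE layer* maps $(X,E,M)$ to $(f(X,E,M),g(X,E,M),M)$. Token mixing $f$ is masked softmax attention with weights $$A_{ij}=\frac{M_{ij}\exp\big((W_Qx_i)^\top\phi(e_i,e_j)W_Kx_j\big)}{\sum_{j'}M_{ij'}\exp\big((W_Qx_i)^\top\phi(e_i,e_{j'})W_Kx_{j'}\big)},\qquad \tilde x_i=\sum_jA_{ij}W_Vx_j+\mathrm{Res}_1\,x_i,$$ followed by $x_i'=\mathrm{FFN}(\tilde x_i)+\mathrm{Res}_2\,\tilde x_i$ with a two-layer perceptron FFN (ReLU or hard-sigmoid activation). Position contextualization $g$ is $$\tilde e_i=\sum_jB(X,E,M)_{ij}\,U_Ve_j+\mathrm{Res}_3\,e_i,\qquad e_i'=\psi(x_i)\,\tilde e_i+\mathrm{Res}_4\,\tilde e_i .$$ Here $W_Q,W_K,W_V\in\mathbb R^{C\times C}$, $U_V\in\mathbb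 R^{K\times K}$, $\mathrm{Res}_\bullet\in\{0,1\}$, $\phi$ and $\psi$ are $C\times C$- resp. $K\times K$-matrix-valued functions, and $B$ is $N\times N$-matrix-valued. The layer is *permutation and orthogonally equivariant* if $f(PX,PEO,PMP^\top)=Pf(X,E,M)$ and $g(PX,PEO,PMP^\top)=Pg(X,E,M)O$ for all $N$, $X$, $E$, $M$, all permutation matrices $P$ of the positions and all $O\in O(R)$ acting on the last dimension. A *TAPE transformer* consists of a token embedding, one initial positional encoding used at every position, finitely many TAPE layers, and an output channel; $C,K,R$, the number of layers and all parameters are independent of $N$ (constant width and depth). It is run with the causal mask ($M_{ij}=1$ iff $j\le i$). *Word problem of $\Pi(5)$.* Given transpositions $t_1,\dots,t_n$ of five points, $n\ge0$, decide whether $t_1\cdots t_n=\mathrm{id}$. The model reads the tokens $[\mathrm{bos}],t_1,\dots,t_n$. $\mathsf{NC}^k$ (resp. $\mathsf{TC}^k$) is the class of problems solved by circuit families (one circuit for each input length $n$) of polynomial size and depth $O((\log n)^k)$ with AND and OR gates of fan-in at most two and NOT gates (resp. AND, OR and threshold gates of unbounded fan-in and NOT gates). $\mathsf{AC}^0$ reductions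 are many-one reductions computed by polynomial-size, constant-depth circuits with unbounded fan-in AND and OR gates and NOT gates. **Theorem.** There is a TAPE transformer of constant depth and constant width (with $R=6$), all of whose layers are permutation and orthogonally equivariant, such that: 1. For every $n\ge 0$, all transpositions $t_1,\dots,t_n$ of five points and every $0\le i\le n$, its output at the token with index $i$ (counted from $0$) is exactly $1$ if $t_1\cdots t_i=\mathrm{id}$ and exactly $0$ otherwise. Thus it solves the $\Pi(5)$ word problem exactly, for every input length. 2. In each layer, $B$ is zero, or $B=A$, or $B=(I+M'\odot G)^{-1}$, where $M'$ is $M$ with zero diagonal and $G_{ij}=\langle q^\top e_i,k^\top e_j\rangle$ for fixed $q,k\in\mathbb R^K$. After some layer, a fixed $6\times6$ block of rows of the positional encoding at every position $i$ is the transpose of $$\prod_{j\le i}\big(I-\xi_j\xi_j^\top\big)=I-\sum_{j\le i}w_j\xi_j^\top,\qquad (w_j)_j=\big(I+\mathrm{strictlower}(\Xi\Xi^\top)\big)^{-1}\Xi,$$ where $\xi_j=\delta_{a}-\delta_{b}\in\mathbb R^6$ if the $j$-th token is the transposition $(a\,b)$ with $a<b$, $\xi_j=0$ if it is $[\mathrm{bos}]$,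 and $\Xi$ has rows $\xi_j^\top$ (WY representation). 3. The $\Pi(5)$ word problem is $\mathsf{NC}^1$-complete under $\mathsf{AC}^0$ reductions. Hence the transformer solves every problem in $\mathsf{NC}^1$, in particular every $\mathsf{NC}^1$-complete problem, under $\mathsf{AC}^0$ reductions: for every $L\in\mathsf{NC}^1$ over a finite alphabet there is an $\mathsf{AC}^0$ function $r$ into words of transpositions such that, for all $x$, the output of the transformer at the last token on $r(x)$ is $1$ if $x\in L$ and $0$ if $x\notin L$. 4. If $\mathsf{TC}^0\ne\mathsf{NC}^1$, the problem solved in (1) is not in $\mathsf{TC}^0$; so no model from a class whose power is contained in $\mathsf{TC}^0$ solves it. -/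

import Mathlib

open Matrix

namespace TAPE

noncomputable section

/-! ## Boolean circuits, the classes NC^k and TC^k, and AC^0 reductions -/

/-- A gate of a straight-line circuit over input variables `ι`, placed after `n` earlier gates.
Its wires lead to earlier gates; `and ∅` and `or ∅` are the constants. The gate `thr t S`
fires when at least `t` of the wires in `S` carry the value true. -/
inductive Gate (ι : Type) (n : ℕ) : Type
  | input (i : ι)
  | not (j : Fin n)
  | and (S : Finset (Fin n))
  | or (S : Finset (Fin n))
  | thr (t : ℕ) (S : Finset (Fin n))

/-- The value of a gate, given the input bits and the values of the earlier gates. -/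
def Gate.eval {ι : Type} {n : ℕ} (x : ι → Bool) (v : Fin n → Bool) : Gate ι n → Bool
  | .input i => x i
  | .not j => !(v j)
  | .and S => decide (∀ j ∈ S, v j = true)
  | .or S => decide (∃ j ∈ S, v j = true)
  | .thr t S => decide (t ≤ (S.filter fun j => v j = true).card)

/-- The depth of a gate, given the depths of the earlier gates. -/
def Gate.depth {ι : Type} {n : ℕ} (d : Fin n → ℕ) : Gate ι n → ℕ
  | .input _ => 0
  | .not j => d j + 1
  | .and S => S.sup d + 1
  | .or S => S.sup d + 1
  | .thr _ S => S.sup d + 1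

/-- Gates of bounded fan-in: AND, OR of fan-in at most two, and NOT. -/
def Gate.IsNC {ι : Type} {n : ℕ} : Gate ι n → Prop
  | .and S => S.card ≤ 2
  | .or S => S.card ≤ 2
  | .thr _ _ => False
  | _ => True

/-- Gates AND, OR of unbounded fan-in, and NOT. -/
def Gate.IsAC {ι : Type} {n : ℕ} : Gate ι n → Prop
  | .thr _ _ => False
  | _ => True

/-- Gates AND, OR, threshold of unbounded fan-in, and NOT. -/
def Gate.IsTC {ι : Type} {n : ℕ} (_ : Gate ι n) : Prop := True

/-- A Boolean circuit (a directed acyclic graph of gates, listed in topological order) with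
input variables `ι` and `n` gates. -/
inductive Circuit (ι : Type) : ℕ → Type
  | nil : Circuit ι 0
  | snoc {n : ℕ} (c : Circuit ι n) (g : Gate ι n) : Circuit ι (n + 1)

/-- The values of all gates of a circuit. -/
def Circuit.eval {ι : Type} (x : ι → Bool) : {n : ℕ} → Circuit ι n → Fin n → Bool
  | _, .nil => Fin.elim0
  | _, .snoc c g => Fin.snoc (α := fun _ => Bool) (c.eval x) (g.eval x (c.eval x))

/-- The depths of all gates of a circuit. -/
def Circuit.depth {ι : Type} : {n : ℕ} → Circuit ι n → Fin n → ℕ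
  | _, .nil => Fin.elim0
  | _, .snoc c g => Fin.snoc (α := fun _ => ℕ) c.depth (g.depth c.depth)

/-- All gates of the circuit belong to a given gate family. -/
def Circuit.All {ι : Type} (P : ∀ {m : ℕ}, Gate ι m → Prop) : {n : ℕ} → Circuit ι n → Prop
  | _, .nil => True
  | _, .snoc c g => c.All P ∧ P g

/-- The bits that encode a word of length `n` over the alphabet `α`: one bit for every position
and every letter. (For `α = Bool`: the input bits and their negations.) -/
def oneHot {α : Type} [DecidableEq α] {n : ℕ} (x : Fin n → α) : Fin n × α → Bool :=
  fun p => decide (x p.1 = p.2)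

/-- Problems over the alphabet `α` solved by a family of circuits with one circuit for each input
length `n`, gates in the family `P`, polynomial size, and depth `O((log n)^k)`. -/
def CircuitClass (P : ∀ {ι : Type} {m : ℕ}, Gate ι m → Prop) (k : ℕ)
    (α : Type) [DecidableEq α] : Set (Language α) :=
  {L | ∃ c : ℕ, ∀ n : ℕ, ∃ (s : ℕ) (D : Circuit (Fin n × α) s) (o : Fin s),
    D.All P ∧ s ≤ n ^ c + c ∧ D.depth o ≤ c * (Nat.log 2 n + 1) ^ k ∧
    ∀ x : Fin n → α, D.eval (oneHot x) o = true ↔ List.ofFn x ∈ L}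

/-- The class NC^k over the alphabet `α`. -/
def NC (k : ℕ) (α : Type) [DecidableEq α] : Set (Language α) := CircuitClass Gate.IsNC k α

/-- The class TC^k over the alphabet `α`. -/
def TC (k : ℕ) (α : Type) [DecidableEq α] : Set (Language α) := CircuitClass Gate.IsTC k α

/-- `r` is an AC^0 function: the length of `r x` depends only on the length of `x` and is
polynomially bounded, and polynomial-size constant-depth circuits with AND, OR and NOT gates
compute every letter of `r x`. -/
def IsAC0Function {α β : Type} [DecidableEq α] (r : List α → List β) : Prop :=
  ∃ (c : ℕ) (len : ℕ → ℕ), ∀ n : ℕ, len n ≤ n ^ c + c ∧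
    ∃ (s : ℕ) (D : Circuit (Fin n × α) s) (out : Fin (len n) → β → Fin s),
      D.All Gate.IsAC ∧ s ≤ n ^ c + c ∧ (∀ j b, D.depth (out j b) ≤ c) ∧
      ∀ x : Fin n → α, (r (List.ofFn x)).length = len n ∧
        ∀ j b, D.eval (oneHot x) (out j b) = true ↔ (r (List.ofFn x))[(j : ℕ)]? = some b

/-- AC^0 (many-one) reducibility. -/
def AC0Reduces {α β : Type} [DecidableEq α] (L : Language α) (L' : Language β) : Prop :=
  ∃ r : List α → List β, IsAC0Function r ∧ ∀ x, x ∈ L ↔ r x ∈ L'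

/-- NC^1-completeness under AC^0 reductions. -/
def NC1Complete {β : Type} [DecidableEq β] (L' : Language β) : Prop :=
  L' ∈ NC 1 β ∧
    ∀ (α : Type) [Fintype α] [DecidableEq α] (L : Language α), L ∈ NC 1 α → AC0Reduces L L'

/-! ## The word problem of the symmetric group on five points, generated by transpositions -/

/-- The ten transpositions of five points, each given by `src < dst`. -/
abbrev Transp : Type := {p : Fin 5 × Fin 5 // p.1 < p.2}

/-- The transposition as a permutation. -/
def Transp.perm (t : Transp) : Equiv.Perm (Fin 5) := Equiv.swap t.1.1 t.1.2

/-- The product `t₁ ⋯ t_N` of a word of transpositions. -/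
def reduce (w : List Transp) : Equiv.Perm (Fin 5) := (w.map Transp.perm).prod

/-- The words of transpositions whose product is the identity. -/
def wordProblem : Language Transp := {w | reduce w = 1}

/-- The vocabulary: the ten transpositions and the beginning-of-sequence token `none`. -/
abbrev Token : Type := Option Transp

/-- The token sequence `[bos], t₁, …, t_n` of a word of transpositions. -/
def tokens (w : List Transp) : Fin (w.length + 1) → Token :=
  Fin.cons none fun i => some (w.get i)

/-! ## Transformers with contextualized equivariant positional encoding -/

/-- Token features: one vector in `ℝ^C` for every position. -/
abbrev Feat (N C : ℕ) : Type := Fin N → Fin C → ℝ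

/-- Positional encodings: one `K × R` matrix for every position, where `K` is the number `M L` of
flattened block rows. -/
abbrev Pos (N K R : ℕ) : Type := Fin N → Matrix (Fin K) (Fin R) ℝ

/-- Masks in `{0,1}^{N × N}`. -/
abbrev Mask (N : ℕ) : Type := Fin N → Fin N → Bool

/-- The mask entry as a real number. -/
def Mask.val {N : ℕ} (M : Mask N) (i j : Fin N) : ℝ := if M i j then 1 else 0

/-- The causal (lower-triangular) mask. -/
def causal (N : ℕ) : Mask N := fun i j => decide (j ≤ i)

/-- Activation functions of the feedforward maps. -/
inductive Activation : Type
  | relu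
  | hardSigmoid

/-- The activation as a function: `max 0 t`, respectively `min 1 (max 0 t)`. -/
def Activation.fn : Activation → ℝ → ℝ
  | .relu, t => max 0 t
  | .hardSigmoid, t => min 1 (max 0 t)

/-- The contribution `Res · y` of a skip connection with `Res ∈ {0, 1}`. -/
def skip {Y : Type} [Zero Y] (res : Bool) (y : Y) : Y := if res then y else 0

/-- The parameters of one layer. -/
structure Layer (C K R : ℕ) where
  /-- query, key and value matrices -/
  WQ : Matrix (Fin C) (Fin C) ℝ
  WK : Matrix (Fin C) (Fin C) ℝ
  WV : Matrix (Fin C) (Fin C) ℝ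
  /-- injection of the positional encodings into the attention logits -/
  φ : Matrix (Fin K) (Fin R) ℝ → Matrix (Fin K) (Fin R) ℝ → Matrix (Fin C) (Fin C) ℝ
  resFAttn : Bool
  /-- the two-layer element-wise MLP on token features -/
  hidden : ℕ
  W₁ : Matrix (Fin hidden) (Fin C) ℝ
  b₁ : Fin hidden → ℝ
  act : Activation
  W₂ : Matrix (Fin C) (Fin hidden) ℝ
  b₂ : Fin C → ℝ
  resFFFN : Bool
  /-- aggregation weights of the position contextualization -/
  B : (N : ℕ) → Feat N C → Pos N K R → Mask N → Matrix (Fin N) (Fin N) ℝ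
  UV : Matrix (Fin K) (Fin K) ℝ
  resGAttn : Bool
  /-- point-wise modulation of the positional encodings by the token features -/
  ψ : (Fin C → ℝ) → Matrix (Fin K) (Fin K) ℝ
  resGFFN : Bool

namespace Layer

variable {C K R N : ℕ} (l : Layer C K R)

/-- Attention logit between positions `i` and `j`. -/
def logit (X : Feat N C) (E : Pos N K R) (i j : Fin N) : ℝ :=
  (l.WQ *ᵥ X i) ⬝ᵥ (l.φ (E i) (E j) *ᵥ (l.WK *ᵥ X j))

/-- Masked softmax attention weights. -/
def attn (X : Feat N C) (E : Pos N K R) (M : Mask N) : Matrix (Fin N) (Fin N) ℝ :=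
  fun i j => M.val i j * Real.exp (l.logit X E i j) /
    ∑ j', M.val i j' * Real.exp (l.logit X E i j')

def fAttn (X : Feat N C) (E : Pos N K R) (M : Mask N) : Feat N C :=
  fun i => (∑ j, l.attn X E M i j • (l.WV *ᵥ X j)) + skip l.resFAttn (X i)

/-- The two-layer MLP. -/
def mlp (x : Fin C → ℝ) : Fin C → ℝ :=
  l.W₂ *ᵥ (fun h => l.act.fn ((l.W₁ *ᵥ x + l.b₁) h)) + l.b₂

def fFFN (X : Feat N C) : Feat N C := fun i => l.mlp (X i) + skip l.resFFFN (X i)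

/-- Token mixing. -/
def f (X : Feat N C) (E : Pos N K R) (M : Mask N) : Feat N C := l.fFFN (l.fAttn X E M)

def gAttn (X : Feat N C) (E : Pos N K R) (M : Mask N) : Pos N K R :=
  fun i => (∑ j, l.B N X E M i j • (l.UV * E j)) + skip l.resGAttn (E i)

def gFFN (X : Feat N C) (E : Pos N K R) : Pos N K R :=
  fun i => l.ψ (X i) * E i + skip l.resGFFN (E i)

/-- Position contextualization. -/
def g (X : Feat N C) (E : Pos N K R) (M : Mask N) : Pos N K R := l.gFFN X (l.gAttn X E M)

/-- Permutation equivariance and orthogonal invariance / equivariance of token mixing and position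
contextualization: for all sequence lengths, inputs and masks, all permutations `σ` of the
positions, and all orthogonal `O` acting on the last dimension of the positional encodings. -/
def Equivariant : Prop :=
  ∀ (N : ℕ) (X : Feat N C) (E : Pos N K R) (M : Mask N) (σ : Equiv.Perm (Fin N)),
    ∀ O ∈ Matrix.orthogonalGroup (Fin R) ℝ,
      l.f (fun i => X (σ i)) (fun i => E (σ i) * O) (fun i j => M (σ i) (σ j)) =
        (fun i => l.f X E M (σ i)) ∧
      l.g (fun i => X (σ i)) (fun i => E (σ i) * O) (fun i j => M (σ i) (σ j)) =
        (fun i => l.g X E M (σ i) * O)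

/-- The weights `(I + M' ⊙ G)⁻¹`, where `G i j` is the inner product of the rows `qᵀ eᵢ` and
`kᵀ eⱼ`, and `M'` is the mask with its diagonal removed. -/
def wyWeights (q k : Fin K → ℝ) (E : Pos N K R) (M : Mask N) : Matrix (Fin N) (Fin N) ℝ :=
  (1 + Matrix.of fun i j =>
    if i = j then 0 else M.val i j * ((q ᵥ* E i) ⬝ᵥ (k ᵥ* E j)))⁻¹

/-- The aggregation weights of the layer are zero, or re-use the attention weights of the layer, or
are WY weights computed from the positional encodings. -/
def ExplicitAggregation : Prop :=
  (∀ N X E M, l.B N X E M = 0) ∨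
  (∀ N X E M, l.B N X E M = l.attn X E M) ∨
  (∃ q k : Fin K → ℝ, ∀ N X E M, l.B N X E M = wyWeights q k E M)

end Layer

/-- A transformer over the vocabulary `Token`. All of its parameters, the number of its layers and
the dimensions `C`, `K`, `R` are independent of the length of the input. Every position starts
with the same positional encoding. The label of a position is read from one output channel. -/
structure Transformer (C K R : ℕ) where
  embed : Token → Fin C → ℝ
  pos₀ : Matrix (Fin K) (Fin R) ℝ
  layers : List (Layer C K R)
  out : Fin C

namespace Transformer

variable {C K R : ℕ} (T : Transformer C K R)

/-- Token features and positional encodings after the first `d` layers, on the token sequence of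
`w` with the causal mask. -/
def state (w : List Transp) (d : ℕ) : Feat (w.length + 1) C × Pos (w.length + 1) K R :=
  (T.layers.take d).foldl
    (fun s l => (l.f s.1 s.2 (causal _), l.g s.1 s.2 (causal _)))
    (fun i => T.embed (tokens w i), fun _ => T.pos₀)

/-- The predicted label of every position. -/
def predict (w : List Transp) (i : Fin (w.length + 1)) : ℝ :=
  (T.state w T.layers.length).1 i T.out

/-- The predicted label of the last position. -/
def decision (w : List Transp) : ℝ := T.predict w (Fin.last _)

/-- Every layer satisfies the two equivariance principles. -/
def Equivariant : Prop := ∀ l ∈ T.layers, l.Equivariant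

/-- On words of every length, at every position, the prediction is exactly `1` if the product of
the transpositions read so far is the identity, and exactly `0` otherwise. -/
def SolvesWordProblem : Prop :=
  ∀ (w : List Transp) (i : Fin (w.length + 1)),
    T.predict w i = if reduce (w.take i) = 1 then 1 else 0

end Transformer

/-! ## Householder products and their WY representation -/

/-- The vector `δ_src - δ_dst` in `ℝ^6`; zero for the beginning-of-sequence token. -/
def ξ : Token → Fin 6 → ℝ
  | none => 0
  | some t => Pi.single t.1.1.castSucc 1 - Pi.single t.1.2.castSucc 1

/-- The product over the tokens up to position `i` of the matrices `I - ξ ξᵀ`. -/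
def householderProduct (w : List Transp) (i : Fin (w.length + 1)) :
    Matrix (Fin 6) (Fin 6) ℝ :=
  (((List.ofFn (tokens w)).take ((i : ℕ) + 1)).map fun t => 1 - vecMulVec (ξ t) (ξ t)).prod

/-- The WY representation `I - ∑_{j ≤ i} w_j ξ_jᵀ`, where the `w_j` are the rows of
`(I + strictLower (Ξ Ξᵀ))⁻¹ Ξ`, and `Ξ` has the rows `ξ_j`. -/
def wyRepresentation (w : List Transp) (i : Fin (w.length + 1)) :
    Matrix (Fin 6) (Fin 6) ℝ :=
  let Ξ : Matrix (Fin (w.length + 1)) (Fin 6) ℝ := Matrix.of fun j => ξ (tokens w j)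
  let S : Matrix (Fin (w.length + 1)) (Fin (w.length + 1)) ℝ :=
    Matrix.of fun a b => if b < a then (Ξ * Ξᵀ) a b else 0
  let W := (1 + S)⁻¹ * Ξ
  1 - ∑ j ∈ Finset.Iic i, vecMulVec (W j) (Ξ j)

/-- All aggregation weights are explicit, and after some layer a fixed block of rows of the
positional encoding of every position is the (transposed) accumulated Householder product, in its
WY representation. -/
def Transformer.AccumulatesHouseholder {C K : ℕ} (T : Transformer C K 6) : Prop :=
  (∀ l ∈ T.layers, l.ExplicitAggregation) ∧
  ∃ d ≤ T.layers.length, ∃ rows : Fin 6 → Fin K,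
    ∀ (w : List Transp) (i : Fin (w.length + 1)),
      (((T.state w d).2 i).submatrix rows id)ᵀ = wyRepresentation w i ∧
      wyRepresentation w i = householderProduct w i

end

end TAPE

open TAPE

namespace TAPE

/-! ## Boolean formulas and circuits -/

/-- Boolean formulas of fan-in at most two. -/
inductive Formula (ι : Type) : Type
  | var (i : ι)
  | tt
  | not (a : Formula ι)
  | and (a b : Formula ι)

namespace Formula

variable {ι : Type}

def eval (x : ι → Bool) : Formula ι → Bool
  | var i => x i
  | tt => true
  | not a => !a.eval x
  | and a b => a.eval x && b.eval x

def depth : Formula ι → ℕ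
  | var _ => 0
  | tt => 1
  | not a => a.depth + 1
  | and a b => max a.depth b.depth + 1

def size : Formula ι → ℕ
  | var _ => 1
  | tt => 1
  | not a => a.size + 1
  | and a b => a.size + b.size + 1

def ff : Formula ι := not tt

def or (a b : Formula ι) : Formula ι := not (and (not a) (not b))

def xor (a b : Formula ι) : Formula ι := and (or a b) (not (and a b))

@[simp] theorem eval_var (x : ι → Bool) (i : ι) : (var i).eval x = x i := rfl

@[simp] theorem eval_tt (x : ι → Bool) : (tt : Formula ι).eval x = true := rfl

@[simp] theorem eval_ff (x : ι → Bool) : (ff : Formula ι).eval x = false := rfl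

@[simp] theorem eval_not (x : ι → Bool) (a : Formula ι) : a.not.eval x = !a.eval x := rfl

@[simp] theorem eval_and (x : ι → Bool) (a b : Formula ι) :
    (a.and b).eval x = (a.eval x && b.eval x) := rfl

@[simp] theorem eval_or (x : ι → Bool) (a b : Formula ι) :
    (a.or b).eval x = (a.eval x || b.eval x) := by
  simp [or]

@[simp] theorem eval_xor (x : ι → Bool) (a b : Formula ι) :
    (a.xor b).eval x = (a.eval x ^^ b.eval x) := by
  simp only [xor, eval_and, eval_or, eval_not]
  cases a.eval x <;> cases b.eval x <;> rfl

theorem depth_ff : (ff : Formula ι).depth = 2 := rfl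

theorem depth_or (a b : Formula ι) : (a.or b).depth = max a.depth b.depth + 3 := by
  simp only [or, depth]; omega

theorem depth_xor (a b : Formula ι) : (a.xor b).depth = max a.depth b.depth + 4 := by
  simp only [xor, depth, depth_or]; omega

theorem size_add_one_le (F : Formula ι) : F.size + 1 ≤ 2 ^ (F.depth + 1) := by
  induction F with
  | var i => simp [size, depth]
  | tt => simp [size, depth]
  | not a ih =>
    have h : 1 ≤ 2 ^ (a.depth + 1) := Nat.one_le_two_pow
    simp only [size, depth]
    rw [pow_succ 2 (a.depth + 1)]
    omega
  | and a b iha ihb =>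
    have ha : 2 ^ (a.depth + 1) ≤ 2 ^ (max a.depth b.depth + 1) :=
      Nat.pow_le_pow_right two_pos (by omega)
    have hb : 2 ^ (b.depth + 1) ≤ 2 ^ (max a.depth b.depth + 1) :=
      Nat.pow_le_pow_right two_pos (by omega)
    simp only [size, depth]
    rw [pow_succ 2 (max a.depth b.depth + 1)]
    omega

/-- The disjunction of a list of formulas. -/
def any : List (Formula ι) → Formula ι
  | [] => ff
  | a :: l => or a (any l)

@[simp] theorem eval_any (x : ι → Bool) (l : List (Formula ι)) :
    (any l).eval x = l.any fun a => a.eval x := by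
  induction l with
  | nil => rfl
  | cons a l ih => simp [any, ih]

theorem depth_any_le {l : List (Formula ι)} {D : ℕ} (h : ∀ a ∈ l, a.depth ≤ D) :
    (any l).depth ≤ D + 3 * l.length + 2 := by
  induction l with
  | nil => simp [any, depth_ff]
  | cons a l ih =>
    have h1 := h a (by simp)
    have h2 := ih fun b hb => h b (by simp [hb])
    simp only [any, depth_or, List.length_cons]
    omega

end Formula

theorem Circuit.All.imp {ι : Type} {P Q : ∀ {m : ℕ}, Gate ι m → Prop}
    (h : ∀ {m : ℕ} (g : Gate ι m), P g → Q g) :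
    ∀ {n : ℕ} {D : Circuit ι n}, D.All P → D.All Q
  | _, .nil, _ => trivial
  | _, .snoc _ g, hD => ⟨hD.1.imp h, h g hD.2⟩

theorem Gate.IsNC.isAC {ι : Type} {m : ℕ} {g : Gate ι m} (h : g.IsNC) : g.IsAC := by
  cases g <;> trivial

theorem Circuit.all_isTC {ι : Type} : ∀ {n : ℕ} (D : Circuit ι n), D.All Gate.IsTC
  | _, .nil => trivial
  | _, .snoc c _ => ⟨c.all_isTC, trivial⟩

/-- Every circuit can be extended by gates that compute a given formula. -/
theorem Formula.exists_extension {ι : Type} (F : Formula ι) :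
    ∀ {n : ℕ} (D : Circuit ι n), D.All Gate.IsNC →
      ∃ (m : ℕ) (D' : Circuit ι m) (e : Fin n → Fin m) (o : Fin m),
        D'.All Gate.IsNC ∧ m ≤ n + F.size ∧ (∀ x j, D'.eval x (e j) = D.eval x j) ∧
        (∀ j, D'.depth (e j) = D.depth j) ∧ (∀ x, D'.eval x o = F.eval x) ∧
        D'.depth o ≤ F.depth := by
  induction F with
  | var i =>
    intro n D hD
    refine ⟨n + 1, D.snoc (.input i), Fin.castSucc, Fin.last n, ⟨hD, trivial⟩, le_rfl, ?_, ?_, ?_, ?_⟩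
    all_goals simp [Circuit.eval, Circuit.depth, Gate.eval, Gate.depth]
  | tt =>
    intro n D hD
    refine ⟨n + 1, D.snoc (.and ∅), Fin.castSucc, Fin.last n, ⟨hD, by simp [Gate.IsNC]⟩, le_rfl,
      ?_, ?_, ?_, ?_⟩
    all_goals simp [Circuit.eval, Circuit.depth, Gate.eval, Gate.depth, Formula.depth]
  | not a ih =>
    intro n D hD
    obtain ⟨m, D', e, o, hD', hm, he, hed, ho, hod⟩ := ih D hD
    refine ⟨m + 1, D'.snoc (.not o), fun j => (e j).castSucc, Fin.last m, ⟨hD', trivial⟩, ?_,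
      ?_, ?_, ?_, ?_⟩
    · simp only [Formula.size]; omega
    all_goals simp [Circuit.eval, Circuit.depth, Gate.eval, Gate.depth, Formula.depth, he, hed, ho,
      hod]
  | and a b iha ihb =>
    intro n D hD
    obtain ⟨m, D', e, o, hD', hm, he, hed, ho, hod⟩ := iha D hD
    obtain ⟨m', D'', e', o', hD'', hm', he', hed', ho', hod'⟩ := ihb D' hD'
    refine ⟨m' + 1, D''.snoc (.and {e' o, o'}), fun j => (e' (e j)).castSucc, Fin.last m',
      ⟨hD'', Finset.card_le_two⟩, ?_, ?_, ?_, ?_, ?_⟩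
    · simp only [Formula.size]; omega
    all_goals simp [Circuit.eval, Circuit.depth, Gate.eval, Gate.depth, Formula.depth, he, hed, ho,
      he', hed', ho']
    omega

/-- A circuit that computes all formulas of a list. -/
theorem Formula.exists_circuit {ι : Type} (l : List (Formula ι)) :
    ∃ (m : ℕ) (D : Circuit ι m), D.All Gate.IsNC ∧ m ≤ (l.map Formula.size).sum ∧
      ∀ F ∈ l, ∃ o : Fin m, (∀ x, D.eval x o = F.eval x) ∧ D.depth o ≤ F.depth := by
  induction l with
  | nil => exact ⟨0, .nil, trivial, by simp, by simp⟩
  | cons F l ih =>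
    obtain ⟨m, D, hD, hm, hl⟩ := ih
    obtain ⟨m', D', e, o, hD', hm', he, hed, ho, hod⟩ := F.exists_extension D hD
    refine ⟨m', D', hD', ?_, ?_⟩
    · simp only [List.map_cons, List.sum_cons]; omega
    · intro G hG
      rcases List.mem_cons.1 hG with rfl | hG
      · exact ⟨o, ho, hod⟩
      · obtain ⟨p, hp, hpd⟩ := hl G hG
        exact ⟨e p, fun x => by rw [he, hp], by rw [hed]; exact hpd⟩

/-- Unfolding of a circuit of fan-in two into formulas. -/
theorem Circuit.exists_formula {ι : Type} :
    ∀ {n : ℕ} (D : Circuit ι n), D.All Gate.IsNC → ∀ o : Fin n,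
      ∃ F : Formula ι, (∀ x, F.eval x = D.eval x o) ∧ F.depth ≤ 3 * D.depth o
  | _, .nil, _, o => o.elim0
  | _, .snoc (n := n) c g, hD, o => by
    have ih := c.exists_formula hD.1
    induction o using Fin.lastCases with
    | cast j =>
      obtain ⟨F, hF, hd⟩ := ih j
      exact ⟨F, by simpa [Circuit.eval] using hF, by simpa [Circuit.depth] using hd⟩
    | last =>
      have hg := hD.2
      simp only [Circuit.eval, Circuit.depth, Fin.snoc_last]
      cases g with
      | input i => exact ⟨.var i, fun x => rfl, by simp [Formula.depth]⟩
      | not j =>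
        obtain ⟨F, hF, hd⟩ := ih j
        exact ⟨F.not, fun x => by simp [Gate.eval, hF], by simp only [Formula.depth, Gate.depth]; omega⟩
      | and S =>
        simp only [Gate.IsNC, Nat.le_succ_iff, Nat.le_zero] at hg
        rcases hg with (h | h) | h
        · rw [Finset.card_eq_zero] at h
          subst h
          exact ⟨.tt, fun x => by simp [Gate.eval], by simp [Formula.depth, Gate.depth]⟩
        · obtain ⟨a, rfl⟩ := Finset.card_eq_one.1 h
          obtain ⟨F, hF, hd⟩ := ih a
          exact ⟨F, fun x => by simp [Gate.eval, hF],
            by simp only [Gate.depth, Finset.sup_singleton]; omega⟩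
        · obtain ⟨a, b, -, rfl⟩ := Finset.card_eq_two.1 h
          obtain ⟨F, hF, hd⟩ := ih a
          obtain ⟨G, hG, hd'⟩ := ih b
          exact ⟨F.and G, fun x => by simp [Gate.eval, hF, hG],
            by simp only [Gate.depth, Formula.depth, Finset.sup_insert, Finset.sup_singleton]; omega⟩
      | or S =>
        simp only [Gate.IsNC, Nat.le_succ_iff, Nat.le_zero] at hg
        rcases hg with (h | h) | h
        · rw [Finset.card_eq_zero] at h
          subst h
          exact ⟨.ff, fun x => by simp [Gate.eval], by simp [Formula.depth_ff, Gate.depth]⟩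
        · obtain ⟨a, rfl⟩ := Finset.card_eq_one.1 h
          obtain ⟨F, hF, hd⟩ := ih a
          exact ⟨F, fun x => by simp [Gate.eval, hF],
            by simp only [Gate.depth, Finset.sup_singleton]; omega⟩
        · obtain ⟨a, b, -, rfl⟩ := Finset.card_eq_two.1 h
          obtain ⟨F, hF, hd⟩ := ih a
          obtain ⟨G, hG, hd'⟩ := ih b
          exact ⟨F.or G, fun x => by simp [Gate.eval, hF, hG],
            by simp only [Gate.depth, Formula.depth_or, Finset.sup_insert, Finset.sup_singleton]
               omega⟩
      | thr t S => exact hg.elim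

theorem pow_add_self_mono (n : ℕ) {c d : ℕ} (h : c ≤ d) : n ^ c + c ≤ n ^ d + d := by
  rcases Nat.eq_zero_or_pos n with rfl | hn
  · rcases h.eq_or_lt with rfl | h
    · rfl
    · calc 0 ^ c + c ≤ 1 + c := Nat.add_le_add_right (pow_le_one₀ le_rfl zero_le_one) c
        _ ≤ d := by omega
        _ ≤ _ := Nat.le_add_left _ _
  · exact add_le_add (Nat.pow_le_pow_right hn h) h

theorem two_pow_mul_log_le (a n : ℕ) :
    2 ^ (a * (Nat.log 2 n + 1)) ≤ n ^ (2 * a) + 2 ^ a := by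
  rcases Nat.lt_or_ge n 2 with hn | hn
  · have : Nat.log 2 n = 0 := Nat.log_of_lt hn
    simp [this]
  · have h1 : 2 ^ (Nat.log 2 n + 1) ≤ n ^ 2 := by
      have := Nat.pow_log_le_self 2 (show n ≠ 0 by omega)
      rw [pow_succ, sq]
      exact Nat.mul_le_mul this hn
    calc 2 ^ (a * (Nat.log 2 n + 1)) = (2 ^ (Nat.log 2 n + 1)) ^ a := by
          rw [← pow_mul, mul_comm]
      _ ≤ (n ^ 2) ^ a := Nat.pow_le_pow_left h1 a
      _ = n ^ (2 * a) := by rw [pow_mul]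
      _ ≤ _ := Nat.le_add_right _ _

theorem two_pow_mul_log_le_pow_add (a n : ℕ) :
    2 ^ (a * (Nat.log 2 n + 1)) ≤ n ^ (2 * a + 2 ^ a) + (2 * a + 2 ^ a) := by
  rcases Nat.eq_zero_or_pos a with rfl | ha
  · simp
  · refine (two_pow_mul_log_le a n).trans ?_
    have h : n ^ (2 * a) ≤ n ^ (2 * a + 2 ^ a) + 2 * a := by
      rcases Nat.eq_zero_or_pos n with rfl | hn
      · simp [ha.ne']
      · exact (Nat.pow_le_pow_right hn (Nat.le_add_right _ _)).trans (Nat.le_add_right _ _)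
    linarith

/-- `NC^1` is the class of formulas of logarithmic depth. -/
theorem mem_NC_one_iff {α : Type} [DecidableEq α] {L : Language α} :
    L ∈ NC 1 α ↔ ∃ c : ℕ, ∀ n : ℕ, ∃ F : Formula (Fin n × α),
      F.depth ≤ c * (Nat.log 2 n + 1) ∧
      ∀ x : Fin n → α, F.eval (oneHot x) = true ↔ List.ofFn x ∈ L := by
  constructor
  · rintro ⟨c, hc⟩
    refine ⟨3 * c, fun n => ?_⟩
    obtain ⟨s, D, o, hD, -, hd, hx⟩ := hc n
    obtain ⟨F, hF, hFd⟩ := D.exists_formula hD o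
    refine ⟨F, ?_, fun x => by rw [hF, hx]⟩
    rw [pow_one] at hd
    calc F.depth ≤ 3 * D.depth o := hFd
      _ ≤ 3 * (c * (Nat.log 2 n + 1)) := Nat.mul_le_mul_left 3 hd
      _ = _ := by ring
  · rintro ⟨c, hc⟩
    refine ⟨2 * (c + 1) + 2 ^ (c + 1), fun n => ?_⟩
    obtain ⟨F, hd, hx⟩ := hc n
    obtain ⟨m, D, hD, hm, hl⟩ := Formula.exists_circuit [F]
    obtain ⟨o, ho, hod⟩ := hl F (by simp)
    refine ⟨m, D, o, hD, ?_, ?_, fun x => by rw [ho, hx]⟩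
    · have h1 := F.size_add_one_le
      have h2 : 2 ^ (F.depth + 1) ≤ 2 ^ ((c + 1) * (Nat.log 2 n + 1)) :=
        Nat.pow_le_pow_right two_pos (by rw [add_mul]; omega)
      have h3 := two_pow_mul_log_le_pow_add (c + 1) n
      simp only [List.map_cons, List.map_nil, List.sum_cons, List.sum_nil] at hm
      linarith
    · rw [pow_one]
      refine (hod.trans hd).trans (Nat.mul_le_mul_right _ (by linarith [Nat.zero_le (2 ^ (c + 1))]))

/-- A property of levels that is compatible with products passes from the entries of a list to
their product, with the level the logarithm of the length: the balanced binary tree. -/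
@[to_additive /-- A property of levels that is compatible with sums passes from the entries of a
list to their sum, with the level the logarithm of the length: the balanced binary tree. -/]
theorem balanced_prod {M : Type*} [Monoid M] (P : ℕ → M → Prop) (h1 : P 0 1)
    (hmul : ∀ k a b, P k a → P k b → P (k + 1) (a * b)) :
    ∀ (k : ℕ) (l : List M), l.length ≤ 2 ^ k → (∀ a ∈ l, P 0 a) → P k l.prod
  | 0, l, hl, h => by
    match l, hl with
    | [], _ => simpa using h1
    | [a], _ => simpa using h a (by simp)
  | k + 1, l, hl, h => by
    rw [← List.take_append_drop (2 ^ k) l, List.prod_append]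
    refine hmul k _ _ (balanced_prod P h1 hmul k _ (by simp) fun a ha => h a (List.mem_of_mem_take ha))
      (balanced_prod P h1 hmul k _ ?_ fun a ha => h a (List.mem_of_mem_drop ha))
    rw [List.length_drop, pow_succ] at *
    omega

/-! ## Barrington's theorem -/

/-- An instruction of a branching program over the transpositions. -/
inductive Instr (ι : Type) : Type
  | const (t : Transp)
  | ite (i : ι) (t t' : Transp)

def Instr.eval {ι : Type} (x : ι → Bool) : Instr ι → Transp
  | const t => t
  | ite i t t' => if x i then t else t'

/-- The word that a branching program produces. -/
def evalProgram {ι : Type} (x : ι → Bool) (p : List (Instr ι)) : List Transp :=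
  p.map (Instr.eval x)

theorem reduce_append (v w : List Transp) : reduce (v ++ w) = reduce v * reduce w := by
  simp [reduce]

theorem evalProgram_append {ι : Type} (x : ι → Bool) (p q : List (Instr ι)) :
    evalProgram x (p ++ q) = evalProgram x p ++ evalProgram x q := by
  simp [evalProgram]

theorem exists_transp_perm {a b : Fin 5} (h : a ≠ b) : ∃ t : Transp, t.perm = Equiv.swap a b := by
  rcases h.lt_or_gt with h | h
  · exact ⟨⟨(a, b), h⟩, rfl⟩
  · exact ⟨⟨(b, a), h⟩, Equiv.swap_comm b a⟩

theorem exists_transp_conj (g : Equiv.Perm (Fin 5)) (t : Transp) :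
    ∃ t' : Transp, t'.perm = g * t.perm * g⁻¹ := by
  obtain ⟨t', h⟩ := exists_transp_perm (g.injective.ne t.2.ne)
  exact ⟨t', by rw [h, Transp.perm, Equiv.swap_apply_apply]⟩

theorem exists_word_conj (g : Equiv.Perm (Fin 5)) (w : List Transp) :
    ∃ w' : List Transp, w'.length = w.length ∧ reduce w' = g * reduce w * g⁻¹ := by
  choose f hf using exists_transp_conj g
  refine ⟨w.map f, by simp, ?_⟩
  induction w with
  | nil => simp [reduce]
  | cons t w ih =>
    simp only [reduce, List.map_cons, List.prod_cons, hf] at ih ⊢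
    rw [ih]
    group

/-- The 5-cycle `(0 1 2 3 4)`. -/
def fiveCycle : Equiv.Perm (Fin 5) := finRotate 5

/-- The conjugates of the 5-cycle `(0 1 2 3 4)`. -/
def IsFiveCycle (σ : Equiv.Perm (Fin 5)) : Prop := ∃ g, σ = g * fiveCycle * g⁻¹

theorem IsFiveCycle.conj {σ : Equiv.Perm (Fin 5)} (h : IsFiveCycle σ) (g : Equiv.Perm (Fin 5)) :
    IsFiveCycle (g * σ * g⁻¹) := by
  obtain ⟨k, rfl⟩ := h
  exact ⟨g * k, by group⟩

theorem isFiveCycle_fiveCycle : IsFiveCycle fiveCycle := ⟨1, by simp⟩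

theorem IsFiveCycle.inv {σ : Equiv.Perm (Fin 5)} (h : IsFiveCycle σ) : IsFiveCycle σ⁻¹ := by
  obtain ⟨g, rfl⟩ := h
  have h : fiveCycle⁻¹ =
      (Equiv.swap 0 4 * Equiv.swap 1 3) * fiveCycle * (Equiv.swap 0 4 * Equiv.swap 1 3)⁻¹ := by
    decide
  have : IsFiveCycle fiveCycle⁻¹ := ⟨_, h⟩
  simpa [mul_assoc] using this.conj g

set_option maxRecDepth 8000 in
theorem fiveCycle_eq_commutator :
    ∃ a b, IsFiveCycle a ∧ IsFiveCycle b ∧ fiveCycle = a * b * a⁻¹ * b⁻¹ := by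
  refine ⟨_, _, ⟨Equiv.swap 1 2 * Equiv.swap 3 4, rfl⟩, ⟨Equiv.swap 2 4 * Equiv.swap 3 4, rfl⟩, ?_⟩
  decide

theorem IsFiveCycle.exists_commutator {σ : Equiv.Perm (Fin 5)} (h : IsFiveCycle σ) :
    ∃ a b, IsFiveCycle a ∧ IsFiveCycle b ∧ σ = a * b * a⁻¹ * b⁻¹ := by
  obtain ⟨g, rfl⟩ := h
  obtain ⟨a, b, ha, hb, h⟩ := fiveCycle_eq_commutator
  refine ⟨_, _, ha.conj g, hb.conj g, ?_⟩
  rw [h]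
  group

theorem exists_word_fiveCycle : ∃ w : List Transp, w.length = 4 ∧ reduce w = fiveCycle := by
  refine ⟨[⟨(0, 1), by decide⟩, ⟨(1, 2), by decide⟩, ⟨(2, 3), by decide⟩, ⟨(3, 4), by decide⟩],
    rfl, ?_⟩
  decide

theorem IsFiveCycle.exists_word {σ : Equiv.Perm (Fin 5)} (h : IsFiveCycle σ) :
    ∃ t₁ t₂ t₃ t₄ : Transp, reduce [t₁, t₂, t₃, t₄] = σ := by
  obtain ⟨g, rfl⟩ := h
  obtain ⟨w, hw, h⟩ := exists_word_fiveCycle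
  obtain ⟨w', hw', h'⟩ := exists_word_conj g w
  rw [hw] at hw'
  match w', hw' with
  | [a, b, c, d], _ => exact ⟨a, b, c, d, by rw [h', h]⟩

/-- Barrington's theorem: a formula of depth `d` is computed by a program of length `4 * 16 ^ d`
that produces a given 5-cycle or the identity. -/
theorem Formula.exists_program {ι : Type} (F : Formula ι) :
    ∀ σ, IsFiveCycle σ → ∃ p : List (Instr ι), p.length ≤ 4 * 16 ^ F.depth ∧
      ∀ x, reduce (evalProgram x p) = if F.eval x then σ else 1 := by
  induction F with
  | var i =>
    intro σ hσ
    obtain ⟨a, b, c, d, h⟩ := hσ.exists_word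
    refine ⟨[.ite i a a, .ite i b a, .ite i c a, .ite i d a], by simp [depth], fun x => ?_⟩
    rw [eval_var]
    cases hx : x i
    · simp [evalProgram, Instr.eval, hx, reduce, Transp.perm]
    · simpa [evalProgram, Instr.eval, hx] using h
  | tt =>
    intro σ hσ
    obtain ⟨a, b, c, d, h⟩ := hσ.exists_word
    exact ⟨[.const a, .const b, .const c, .const d], by simp [depth], fun x => by
      simpa [evalProgram, Instr.eval] using h⟩
  | not F ih =>
    intro σ hσ
    obtain ⟨a, b, c, d, h⟩ := hσ.exists_word
    obtain ⟨p, hp, hx⟩ := ih _ hσ.inv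
    refine ⟨p ++ [.const a, .const b, .const c, .const d], ?_, fun x => ?_⟩
    · have : 1 ≤ 16 ^ F.depth := Nat.one_le_pow _ _ (by norm_num)
      simp only [List.length_append, List.length_cons, List.length_nil, depth, pow_succ]
      omega
    · have hc : evalProgram x [Instr.const a, .const b, .const c, .const d] = [a, b, c, d] := rfl
      rw [evalProgram_append, reduce_append, hx, hc, h, eval_not]
      cases F.eval x <;> simp
  | and F G ihF ihG =>
    intro σ hσ
    obtain ⟨a, b, ha, hb, rfl⟩ := hσ.exists_commutator
    obtain ⟨p₁, hp₁, h₁⟩ := ihF _ ha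
    obtain ⟨p₂, hp₂, h₂⟩ := ihG _ hb
    obtain ⟨p₃, hp₃, h₃⟩ := ihF _ ha.inv
    obtain ⟨p₄, hp₄, h₄⟩ := ihG _ hb.inv
    refine ⟨p₁ ++ p₂ ++ p₃ ++ p₄, ?_, fun x => ?_⟩
    · have hF : 16 ^ F.depth ≤ 16 ^ (max F.depth G.depth) :=
        Nat.pow_le_pow_right (by norm_num) (le_max_left _ _)
      have hG : 16 ^ G.depth ≤ 16 ^ (max F.depth G.depth) :=
        Nat.pow_le_pow_right (by norm_num) (le_max_right _ _)
      simp only [List.length_append, depth, pow_succ]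
      omega
    · simp only [evalProgram_append, reduce_append, h₁, h₂, h₃, h₄, eval_and]
      rcases Bool.eq_false_or_eq_true (F.eval x) with h | h <;>
        rcases Bool.eq_false_or_eq_true (G.eval x) with h' | h' <;> simp [h, h']

/-- The formula that decides whether an instruction produces a given letter. -/
def Instr.formula {ι : Type} (b : Transp) : Instr ι → Formula ι
  | const t => if t = b then .tt else .ff
  | ite i t t' => if t = b then (if t' = b then .tt else .var i) else
      if t' = b then .not (.var i) else .ff

theorem Instr.eval_formula {ι : Type} (b : Transp) (s : Instr ι) (x : ι → Bool) :
    (s.formula b).eval x = true ↔ s.eval x = b := by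
  cases s with
  | const t => by_cases h : t = b <;> simp [formula, eval, h]
  | ite i t t' =>
    by_cases h : t = b <;> by_cases h' : t' = b <;> cases hx : x i <;>
      simp [formula, eval, h, h', hx]

theorem Instr.depth_formula_le {ι : Type} (b : Transp) (s : Instr ι) : (s.formula b).depth ≤ 2 := by
  cases s <;> simp only [formula] <;> split_ifs <;> simp [Formula.depth, Formula.ff]

theorem Instr.size_formula_le {ι : Type} (b : Transp) (s : Instr ι) : (s.formula b).size ≤ 2 := by
  cases s <;> simp only [formula] <;> split_ifs <;> simp [Formula.size, Formula.ff]

theorem equivSigmaTuple_ofFn {α : Type} {n : ℕ} (x : Fin n → α) :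
    List.equivSigmaTuple (List.ofFn x) = ⟨n, x⟩ :=
  List.equivSigmaTuple.apply_symm_apply ⟨n, x⟩

/-- The function on words that a family of branching programs computes. -/
def programFunction {α : Type} [DecidableEq α] (p : ∀ n : ℕ, List (Instr (Fin n × α)))
    (l : List α) : List Transp :=
  evalProgram (oneHot (List.equivSigmaTuple l).2) (p (List.equivSigmaTuple l).1)

theorem programFunction_ofFn {α : Type} [DecidableEq α] (p : ∀ n : ℕ, List (Instr (Fin n × α)))
    {n : ℕ} (x : Fin n → α) : programFunction p (List.ofFn x) = evalProgram (oneHot x) (p n) := by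
  rw [programFunction, equivSigmaTuple_ofFn]

/-- Programs of polynomial length define `AC^0` functions. -/
theorem isAC0Function_programFunction {α : Type} [DecidableEq α]
    (p : ∀ n : ℕ, List (Instr (Fin n × α))) (a : ℕ)
    (hp : ∀ n, (p n).length ≤ 2 ^ (a * (Nat.log 2 n + 1))) :
    IsAC0Function (programFunction p) := by
  have hmono := fun n => (two_pow_mul_log_le_pow_add (a + 5) n)
  refine ⟨2 * (a + 5) + 2 ^ (a + 5), fun n => (p n).length, fun n => ?_⟩
  have hlen : (p n).length * 20 ≤
      n ^ (2 * (a + 5) + 2 ^ (a + 5)) + (2 * (a + 5) + 2 ^ (a + 5)) := by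
    refine le_trans ?_ (hmono n)
    calc (p n).length * 20 ≤ 2 ^ (a * (Nat.log 2 n + 1)) * 2 ^ (5 * (Nat.log 2 n + 1)) :=
          Nat.mul_le_mul (hp n) (le_trans (by norm_num)
            (Nat.pow_le_pow_right two_pos (show 5 ≤ 5 * (Nat.log 2 n + 1) by omega)))
      _ = _ := by rw [← pow_add, ← add_mul]
  refine ⟨by linarith [Nat.zero_le (p n).length], ?_⟩
  obtain ⟨m, D, hD, hm, hF⟩ := Formula.exists_circuit
    ((p n).flatMap fun s => (Finset.univ : Finset Transp).toList.map fun b => s.formula b)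
  have hmem (j : Fin (p n).length) (b : Transp) : (p n)[j].formula b ∈
      (p n).flatMap fun s => (Finset.univ : Finset Transp).toList.map fun b => s.formula b := by
    simp only [List.mem_flatMap, List.mem_map, Finset.mem_toList, Finset.mem_univ, true_and]
    exact ⟨_, List.getElem_mem _, b, rfl⟩
  choose out hout hdepth using fun j b => hF _ (hmem j b)
  refine ⟨m, D, out, hD.imp fun g hg => hg.isAC, ?_, fun j b => ?_, fun x => ?_⟩
  · refine hm.trans (le_trans ?_ hlen)
    have h := List.sum_le_card_nsmul (((p n).flatMap fun s =>
      (Finset.univ : Finset Transp).toList.map fun b => s.formula b).map Formula.size) 2 (by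
        simp only [List.mem_map, List.mem_flatMap, forall_exists_index, and_imp]
        rintro _ F s - b - rfl rfl
        exact s.size_formula_le b)
    refine h.trans (le_of_eq ?_)
    have hc : Fintype.card Transp = 10 := by decide
    simp [List.length_flatMap, hc]
    ring
  · calc _ ≤ 2 := (hdepth j b).trans (Instr.depth_formula_le _ _)
      _ ≤ _ := by linarith [Nat.zero_le (2 ^ (a + 5))]
  · rw [programFunction_ofFn]
    refine ⟨by simp [evalProgram], fun j b => ?_⟩
    rw [hout, Instr.eval_formula]
    simp [evalProgram]

/-- Every problem in `NC^1` reduces to the word problem. -/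
theorem reduces_wordProblem {α : Type} [DecidableEq α] {L : Language α} (hL : L ∈ NC 1 α) :
    AC0Reduces L wordProblem := by
  obtain ⟨c, hc⟩ := mem_NC_one_iff.1 hL
  choose F hd hF using hc
  choose p hp hx using fun n => (F n).not.exists_program _ isFiveCycle_fiveCycle
  refine ⟨_, isAC0Function_programFunction p (4 * c + 6) fun n => (hp n).trans ?_, fun l => ?_⟩
  · simp only [Formula.depth]
    calc 4 * 16 ^ ((F n).depth + 1) = 2 ^ (2 + 4 * ((F n).depth + 1)) := by
          rw [pow_add 2 2, pow_mul 2 4]; norm_num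
      _ ≤ _ := Nat.pow_le_pow_right two_pos (by nlinarith [hd n])
  · obtain ⟨n, x, rfl⟩ : ∃ (n : ℕ) (x : Fin n → α), l = List.ofFn x :=
      ⟨_, _, (List.ofFn_get l).symm⟩
    rw [← hF n x, programFunction_ofFn]
    change _ ↔ reduce _ = 1
    rw [hx, Formula.eval_not]
    have : fiveCycle ≠ 1 := by decide
    cases (F n).eval (oneHot x) <;> simp [this]

/-! ## The word problem is in `NC^1` -/

theorem list_prod_ofFn_apply {X M : Type*} [Monoid M] {n : ℕ} (f : Fin n → X → M) (x : X) :
    (List.ofFn f).prod x = (List.ofFn fun j => f j x).prod := by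
  rw [Pi.list_prod_apply, List.map_ofFn]
  rfl

theorem wordProblem_mem_NC : wordProblem ∈ NC 1 Transp := by
  refine mem_NC_one_iff.2 ⟨395, fun n => ?_⟩
  let P : ℕ → ((Fin n → Transp) → Equiv.Perm (Fin 5)) → Prop := fun k m =>
    ∃ F : Equiv.Perm (Fin 5) → Formula (Fin n × Transp),
      (∀ σ, (F σ).depth ≤ 32 + 363 * k) ∧ ∀ x σ, (F σ).eval (oneHot x) = true ↔ m x = σ
  have h1 : P 0 1 := by
    refine ⟨fun σ => if 1 = σ then .tt else .ff, fun σ => ?_, fun x σ => ?_⟩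
    · dsimp only
      split_ifs <;> simp [Formula.depth, Formula.depth_ff]
    · by_cases h : 1 = σ <;> simp [h]
  have hmul : ∀ k a b, P k a → P k b → P (k + 1) (a * b) := by
    rintro k a b ⟨F, hF, hFx⟩ ⟨G, hG, hGx⟩
    refine ⟨fun σ => .any ((Finset.univ : Finset (Equiv.Perm (Fin 5))).toList.map fun τ =>
      (F τ).and (G (τ⁻¹ * σ))), fun σ => ?_, fun x σ => ?_⟩
    · refine (Formula.depth_any_le (D := 32 + 363 * k + 1) ?_).trans ?_
      · simp only [List.mem_map, forall_exists_index, and_imp]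
        rintro _ τ - rfl
        have h1 := hF τ
        have h2 := hG (τ⁻¹ * σ)
        simp only [Formula.depth]
        omega
      · simp only [List.length_map, Finset.length_toList, Finset.card_univ, Fintype.card_perm,
          Fintype.card_fin]
        norm_num [Nat.factorial]
        omega
    · simp [hFx, hGx, eq_inv_mul_iff_mul_eq]
  have hleaf : ∀ m ∈ List.ofFn fun (j : Fin n) (x : Fin n → Transp) => (x j).perm, P 0 m := by
    intro m hm
    obtain ⟨j, rfl⟩ := (List.mem_ofFn' _ _).1 hm
    refine ⟨fun σ => .any (((Finset.univ.filter fun t : Transp => t.perm = σ)).toList.map fun t =>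
      .var (j, t)), fun σ => ?_, fun x σ => ?_⟩
    · refine (Formula.depth_any_le (D := 0) ?_).trans ?_
      · simp only [List.mem_map, forall_exists_index, and_imp]
        rintro _ t - rfl
        exact le_rfl
      · have h : (Finset.univ.filter fun t : Transp => t.perm = σ).card ≤ 10 :=
          Finset.card_le_univ _
        simp only [List.length_map, Finset.length_toList]
        omega
    · simp [oneHot]
  obtain ⟨F, hF, hx⟩ := balanced_prod P h1 hmul (Nat.log 2 n + 1) _
    (by simpa using (Nat.lt_pow_succ_log_self one_lt_two n).le) hleaf
  refine ⟨F 1, (hF 1).trans (by omega), fun x => ?_⟩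
  rw [hx, list_prod_ofFn_apply]
  change _ ↔ reduce _ = 1
  rw [reduce, List.map_ofFn]
  rfl

theorem wordProblem_complete : NC1Complete wordProblem :=
  ⟨wordProblem_mem_NC, fun _ _ _ _ hL => reduces_wordProblem hL⟩

/-! ## Threshold gates in logarithmic depth -/

/-- The number with the binary digits `u 0, …, u (L - 1)`. -/
def binVal (L : ℕ) (u : ℕ → Bool) : ℕ := ∑ i ∈ Finset.range L, 2 ^ i * (u i).toNat

theorem binVal_succ (L : ℕ) (u : ℕ → Bool) :
    binVal (L + 1) u = binVal L u + 2 ^ L * (u L).toNat := Finset.sum_range_succ _ _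

theorem exists_binVal : ∀ (L K : ℕ), K < 2 ^ L → ∃ u, binVal L u = K
  | 0, K, h => ⟨fun _ => false, by simp [binVal]; omega⟩
  | L + 1, K, h => by
    obtain ⟨u, hu⟩ := exists_binVal L (K % 2 ^ L) (Nat.mod_lt _ (by positivity))
    refine ⟨fun i => if i < L then u i else decide (2 ^ L ≤ K), ?_⟩
    have h1 : binVal L (fun i => if i < L then u i else decide (2 ^ L ≤ K)) = binVal L u :=
      Finset.sum_congr rfl fun i hi => by simp [Finset.mem_range.1 hi]
    rw [binVal_succ, h1, hu]
    rw [pow_succ] at h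
    by_cases hK : 2 ^ L ≤ K
    · have h2 : K % 2 ^ L = K - 2 ^ L := by
        rw [Nat.mod_eq_sub_mod hK, Nat.mod_eq_of_lt (by omega)]
      simp [hK, h2]
    · simp [hK, Nat.mod_eq_of_lt (not_le.1 hK)]

/-- Majority of three bits. -/
def maj (a b c : Bool) : Bool := (a && b) || (c && (a || b))

/-- The carries of a carry-save addition, shifted by one place. -/
def shiftMaj (u v w : ℕ → Bool) : ℕ → Bool
  | 0 => false
  | i + 1 => maj (u i) (v i) (w i)

theorem toNat_add_toNat_add_toNat (a b c : Bool) :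
    a.toNat + b.toNat + c.toNat = (a ^^ (b ^^ c)).toNat + 2 * (maj a b c).toNat := by
  cases a <;> cases b <;> cases c <;> rfl

/-- Carry-save addition. -/
theorem binVal_add_binVal_add_binVal (L : ℕ) (u v w : ℕ → Bool) (hu : u L = false)
    (hv : v L = false) :
    binVal L u + binVal L v + binVal (L + 1) w =
      binVal (L + 1) (fun i => u i ^^ (v i ^^ w i)) + binVal (L + 1) (shiftMaj u v w) := by
  have h : binVal (L + 1) (shiftMaj u v w) =
      2 * ∑ i ∈ Finset.range L, 2 ^ i * (maj (u i) (v i) (w i)).toNat := by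
    rw [binVal, Finset.sum_range_succ', Finset.mul_sum]
    simp [shiftMaj, pow_succ', mul_assoc]
  rw [h, binVal_succ, binVal_succ, hu, hv, Bool.false_xor, Bool.false_xor, Finset.mul_sum]
  have : binVal L u + binVal L v + binVal L w = binVal L (fun i => u i ^^ (v i ^^ w i)) +
      ∑ i ∈ Finset.range L, 2 * (2 ^ i * (maj (u i) (v i) (w i)).toNat) := by
    simp only [binVal, ← Finset.sum_add_distrib]
    refine Finset.sum_congr rfl fun i _ => ?_
    linear_combination 2 ^ i * toNat_add_toNat_add_toNat (u i) (v i) (w i)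
  linear_combination this

/-- The carries of a ripple-carry addition. -/
def carry (u v : ℕ → Bool) : ℕ → Bool
  | 0 => false
  | i + 1 => maj (u i) (v i) (carry u v i)

theorem carry_eq_true_iff (u v : ℕ → Bool) (L : ℕ) :
    carry u v L = true ↔ 2 ^ L ≤ binVal L u + binVal L v := by
  have h : ∃ s < 2 ^ L, binVal L u + binVal L v = s + 2 ^ L * (carry u v L).toNat := by
    induction L with
    | zero => exact ⟨0, by simp [binVal, carry]⟩
    | succ L ih =>
      obtain ⟨s, hs, h⟩ := ih
      refine ⟨s + 2 ^ L * (u L ^^ (v L ^^ carry u v L)).toNat, ?_, ?_⟩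
      · have := (u L ^^ (v L ^^ carry u v L)).toNat_le
        rw [pow_succ]
        nlinarith
      · rw [binVal_succ, binVal_succ, carry, pow_succ]
        linear_combination h + 2 ^ L * toNat_add_toNat_add_toNat (u L) (v L) (carry u v L)
  obtain ⟨s, hs, h⟩ := h
  rw [h]
  cases carry u v L <;> simp [hs]

namespace Formula

variable {ι : Type}

def const (b : Bool) : Formula ι := if b then tt else ff

@[simp] theorem eval_const (x : ι → Bool) (b : Bool) : (const b : Formula ι).eval x = b := by
  cases b <;> rfl

theorem depth_const_le (b : Bool) : (const b : Formula ι).depth ≤ 2 := by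
  cases b <;> simp [const, depth, depth_ff]

def maj (a b c : Formula ι) : Formula ι := or (and a b) (and c (or a b))

theorem eval_maj (x : ι → Bool) (a b c : Formula ι) :
    (maj a b c).eval x = TAPE.maj (a.eval x) (b.eval x) (c.eval x) := by
  simp [maj, TAPE.maj]

theorem depth_maj_le (a b c : Formula ι) :
    (maj a b c).depth ≤ max (max (a.depth + 7) (b.depth + 7)) (c.depth + 4) := by
  simp only [maj, depth_or, depth]
  omega

def shiftMaj (u v w : ℕ → Formula ι) : ℕ → Formula ι
  | 0 => ff
  | i + 1 => maj (u i) (v i) (w i)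

theorem eval_shiftMaj (x : ι → Bool) (u v w : ℕ → Formula ι) (i : ℕ) :
    (shiftMaj u v w i).eval x =
      TAPE.shiftMaj (fun i => (u i).eval x) (fun i => (v i).eval x) (fun i => (w i).eval x) i := by
  cases i with
  | zero => rfl
  | succ i => exact eval_maj _ _ _ _

def carry (u v : ℕ → Formula ι) : ℕ → Formula ι
  | 0 => ff
  | i + 1 => maj (u i) (v i) (carry u v i)

theorem eval_carry (x : ι → Bool) (u v : ℕ → Formula ι) (i : ℕ) :
    (carry u v i).eval x = TAPE.carry (fun i => (u i).eval x) (fun i => (v i).eval x) i := by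
  induction i with
  | zero => rfl
  | succ i ih => rw [carry, eval_maj, ih, TAPE.carry]

theorem depth_carry_le {D : ℕ} (u v : ℕ → Formula ι) (hu : ∀ i, (u i).depth ≤ D)
    (hv : ∀ i, (v i).depth ≤ D) (i : ℕ) : (carry u v i).depth ≤ D + 7 + 4 * i := by
  induction i with
  | zero => simp [carry, depth_ff]
  | succ i ih =>
    have h1 := depth_maj_le (u i) (v i) (carry u v i)
    have h2 := hu i
    have h3 := hv i
    rw [carry]
    omega

/-- `m` is the value of a number in carry-save form: a sum of two binary numbers with `L` digits
given by formulas of depth at most `D`. -/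
def CarrySave (D L : ℕ) (m : (ι → Bool) → ℕ) : Prop :=
  ∃ u v : ℕ → Formula ι, (∀ i, (u i).depth ≤ D) ∧ (∀ i, (v i).depth ≤ D) ∧
    (∀ i ≥ L, ∀ x, (u i).eval x = false) ∧ (∀ i ≥ L, ∀ x, (v i).eval x = false) ∧
    ∀ x, m x = binVal L (fun i => (u i).eval x) + binVal L (fun i => (v i).eval x)

theorem depth_xor_xor_le {D : ℕ} {a b c : Formula ι} (ha : a.depth ≤ D) (hb : b.depth ≤ D)
    (hc : c.depth ≤ D) : (a.xor (b.xor c)).depth ≤ D + 8 := by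
  simp only [depth_xor]
  omega

theorem depth_shiftMaj_le {D : ℕ} {u v w : ℕ → Formula ι} (hu : ∀ i, (u i).depth ≤ D)
    (hv : ∀ i, (v i).depth ≤ D) (hw : ∀ i, (w i).depth ≤ D) (i : ℕ) :
    (shiftMaj u v w i).depth ≤ D + 8 := by
  cases i with
  | zero => simp [shiftMaj, depth_ff]
  | succ i =>
    have h := depth_maj_le (u i) (v i) (w i)
    have h1 := hu i
    have h2 := hv i
    have h3 := hw i
    rw [shiftMaj]
    omega

/-- Adding a binary number to a number in carry-save form. -/
theorem CarrySave.add_binary {D L : ℕ} {m : (ι → Bool) → ℕ} (h : CarrySave D L m)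
    (w : ℕ → Formula ι) (hw : ∀ i, (w i).depth ≤ D) (hw' : ∀ i ≥ L + 1, ∀ x, (w i).eval x = false) :
    CarrySave (D + 8) (L + 1) fun x => m x + binVal (L + 1) fun i => (w i).eval x := by
  obtain ⟨u, v, hu, hv, hu', hv', hm⟩ := h
  refine ⟨fun i => (u i).xor ((v i).xor (w i)), shiftMaj u v w,
    fun i => depth_xor_xor_le (hu i) (hv i) (hw i), depth_shiftMaj_le hu hv hw, ?_, ?_, fun x => ?_⟩
  · intro i hi x
    simp [hu' i (by omega) x, hv' i (by omega) x, hw' i hi x]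
  · intro i hi x
    obtain ⟨i, rfl⟩ : ∃ j, i = j + 1 := ⟨i - 1, by omega⟩
    simp [shiftMaj, eval_maj, TAPE.maj, hu' i (by omega) x, hv' i (by omega) x]
  · have := binVal_add_binVal_add_binVal L (fun i => (u i).eval x) (fun i => (v i).eval x)
      (fun i => (w i).eval x) (hu' L le_rfl x) (hv' L le_rfl x)
    simp only [hm, this, eval_xor, eval_shiftMaj]

theorem binVal_eq_of_le {L L' : ℕ} (h : L ≤ L') {u : ℕ → Bool} (hu : ∀ i ≥ L, u i = false) :
    binVal L' u = binVal L u :=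
  (Finset.sum_subset (Finset.range_mono h) fun i _ hi => by
    simp [hu i (by simpa using hi)]).symm

theorem CarrySave.add {D L : ℕ} {m m' : (ι → Bool) → ℕ} (h : CarrySave D L m)
    (h' : CarrySave D L m') : CarrySave (D + 16) (L + 2) (m + m') := by
  obtain ⟨u, v, hu, hv, hu', hv', hm⟩ := h'
  have h1 := h.add_binary u hu fun i hi => hu' i (by omega)
  have h2 := h1.add_binary v (fun i => (hv i).trans (by omega)) fun i hi => hv' i (by omega)
  convert h2 using 1
  funext x
  rw [Pi.add_apply, hm, binVal_eq_of_le (Nat.le_add_right L 1) fun i hi => hu' i hi x,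
    binVal_eq_of_le (Nat.le_add_right L 2) fun i hi => hv' i hi x]
  ring

/-- A threshold of formulas is computed in logarithmic additional depth. -/
theorem exists_threshold (t k D : ℕ) (l : List (Formula ι)) (hl : l.length ≤ 2 ^ k)
    (hD : ∀ F ∈ l, F.depth ≤ D) :
    ∃ F : Formula ι, F.depth ≤ D + 25 * (k + 1) ∧
      ∀ x, F.eval x = true ↔ t ≤ (l.map fun F => (F.eval x).toNat).sum := by
  have hcount (x : ι → Bool) : (l.map fun F => (F.eval x).toNat).sum ≤ l.length := by
    have := List.sum_le_card_nsmul (l.map fun F => (F.eval x).toNat) 1 (by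
      simp only [List.mem_map, forall_exists_index, and_imp]
      rintro _ F - rfl
      exact Bool.toNat_le _)
    simpa using this
  rcases Nat.eq_zero_or_pos t with rfl | ht
  · exact ⟨.tt, by simp [depth]; omega, by simp⟩
  rcases Nat.lt_or_ge (2 ^ k) t with ht' | ht'
  · refine ⟨.ff, by rw [depth_ff]; omega, fun x => ?_⟩
    have := hcount x
    simp only [eval_ff, Bool.false_eq_true, false_iff]
    omega
  have hsum : CarrySave (D + 2 + 16 * k) (1 + 2 * k) fun x => (l.map fun F => (F.eval x).toNat).sum := by
    have h := balanced_sum (M := (ι → Bool) → ℕ)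
      (fun k m => CarrySave (D + 2 + 16 * k) (1 + 2 * k) m) ?_ ?_ k
      (l.map fun F x => (F.eval x).toNat) (by simpa using hl) ?_
    · convert h using 1
      funext x
      rw [Pi.list_sum_apply, List.map_map]
      rfl
    · exact ⟨fun _ => ff, fun _ => ff, by simp [depth_ff], by simp [depth_ff], by simp, by simp,
        by simp [binVal]⟩
    · exact fun k a b ha hb => ha.add hb
    · simp only [List.mem_map, forall_exists_index, and_imp]
      rintro _ F hF rfl
      refine ⟨fun i => if i = 0 then F else ff, fun _ => ff, fun i => ?_, by simp [depth_ff],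
        fun i hi x => ?_, by simp, by simp [binVal]⟩
      · have := hD F hF
        by_cases hi : i = 0
        · simp only [hi, if_true]; omega
        · simp [hi, depth_ff]
      · simp [show i ≠ 0 by omega]
  have hk : 2 ^ k ≤ 2 ^ (1 + 2 * k + 1) := Nat.pow_le_pow_right two_pos (by omega)
  obtain ⟨b, hb⟩ := exists_binVal (1 + 2 * k + 1) (2 ^ (1 + 2 * k + 1) - t) (by omega)
  obtain ⟨u, v, hu, hv, hu', hv', hm⟩ := hsum.add_binary
    (fun i => const (decide (i < 1 + 2 * k + 1) && b i))
    (fun i => (depth_const_le _).trans (by omega))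
    (fun i hi x => by simp [show ¬ i < 1 + 2 * k + 1 by omega])
  refine ⟨carry u v (1 + 2 * k + 1), (depth_carry_le u v hu hv _).trans (by omega), fun x => ?_⟩
  have hb' : binVal (1 + 2 * k + 1) (fun i => decide (i < 1 + 2 * k + 1) && b i) =
      2 ^ (1 + 2 * k + 1) - t := by
    rw [← hb]
    exact Finset.sum_congr rfl fun i hi => by simp [Finset.mem_range.1 hi]
  have hx := hm x
  simp only [eval_const, hb'] at hx
  rw [eval_carry, carry_eq_true_iff, ← hx]
  omega

end Formula

/-! ## `TC^0` and `NC^1` -/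

theorem Formula.exists_threshold_finset {ι : Type} {n : ℕ} (t k D : ℕ) (f : Fin n → Formula ι)
    (hn : n ≤ 2 ^ k) (S : Finset (Fin n)) (hD : ∀ j ∈ S, (f j).depth ≤ D) :
    ∃ F : Formula ι, F.depth ≤ D + 25 * (k + 1) ∧
      ∀ x, F.eval x = true ↔ t ≤ (S.filter fun j => (f j).eval x = true).card := by
  have hS : S.card ≤ n := (Finset.card_le_univ S).trans_eq (Fintype.card_fin n)
  obtain ⟨F, hF, h⟩ := exists_threshold t k D (S.toList.map f) (by simpa using hS.trans hn) (by
    simp only [List.mem_map, Finset.mem_toList, forall_exists_index, and_imp]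
    rintro _ j hj rfl
    exact hD j hj)
  refine ⟨F, hF, fun x => ?_⟩
  rw [h, List.map_map, Finset.card_filter, ← Finset.sum_map_toList]
  refine Eq.to_iff (congrArg (fun r : List ℕ => t ≤ r.sum) (List.map_congr_left fun j _ => ?_))
  cases h : (f j).eval x <;> simp [h]

theorem Gate.exists_thr {ι : Type} {n : ℕ} (g : Gate ι n) :
    (∃ i, g = .input i) ∨ (∃ j, g = .not j) ∨ ∃ (t : ℕ) (S : Finset (Fin n)),
      (∀ x v, g.eval x v = (Gate.thr t S : Gate ι n).eval x v) ∧
      ∀ d, g.depth d = (Gate.thr t S : Gate ι n).depth d := by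
  cases g with
  | input i => exact .inl ⟨i, rfl⟩
  | not j => exact .inr (.inl ⟨j, rfl⟩)
  | thr t S => exact .inr (.inr ⟨t, S, fun _ _ => rfl, fun _ => rfl⟩)
  | and S =>
    refine .inr (.inr ⟨S.card, S, fun x v => ?_, fun _ => rfl⟩)
    simp only [Gate.eval, decide_eq_decide]
    rw [← Finset.filter_eq_self]
    exact ⟨fun h => by rw [h], Finset.eq_of_subset_of_card_le (Finset.filter_subset _ _)⟩
  | or S =>
    refine .inr (.inr ⟨1, S, fun x v => ?_, fun _ => rfl⟩)
    simp only [Gate.eval, decide_eq_decide]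
    rw [Nat.one_le_iff_ne_zero, ← Nat.pos_iff_ne_zero, Finset.card_pos]
    exact ⟨fun ⟨j, hj, h⟩ => ⟨j, by simp [hj, h]⟩, fun ⟨j, hj⟩ => by
      rw [Finset.mem_filter] at hj
      exact ⟨j, hj⟩⟩

/-- Unfolding of a threshold circuit into formulas. -/
theorem Circuit.exists_formula_of_threshold {ι : Type} (k : ℕ) :
    ∀ {n : ℕ} (D : Circuit ι n), n ≤ 2 ^ k → ∀ o : Fin n,
      ∃ F : Formula ι, (∀ x, F.eval x = D.eval x o) ∧ F.depth ≤ 25 * (k + 1) * D.depth o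
  | _, .nil, _, o => o.elim0
  | _, .snoc (n := n) c g, hn, o => by
    have ih := c.exists_formula_of_threshold k (by omega)
    induction o using Fin.lastCases with
    | cast j =>
      obtain ⟨F, hF, hd⟩ := ih j
      exact ⟨F, by simpa [Circuit.eval] using hF, by simpa [Circuit.depth] using hd⟩
    | last =>
      simp only [Circuit.eval, Circuit.depth, Fin.snoc_last]
      rcases g.exists_thr with ⟨i, rfl⟩ | ⟨j, rfl⟩ | ⟨t, S, hg, hgd⟩
      · exact ⟨.var i, fun x => rfl, by simp [Formula.depth]⟩
      · obtain ⟨F, hF, hd⟩ := ih j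
        refine ⟨F.not, fun x => by simp [Gate.eval, hF], ?_⟩
        simp only [Formula.depth, Gate.depth]
        rw [mul_add]
        omega
      · choose f hf hd using ih
        obtain ⟨F, hF, h⟩ := Formula.exists_threshold_finset t k
          (25 * (k + 1) * S.sup c.depth) f (by omega) S fun j hj =>
            (hd j).trans (Nat.mul_le_mul_left _ (Finset.le_sup hj))
        refine ⟨F, fun x => ?_, ?_⟩
        · rw [hg, Bool.eq_iff_iff, h]
          simp [Gate.eval, hf]
        · rw [hgd]
          simp only [Gate.depth]
          rw [mul_add]
          omega

theorem le_two_pow_mul_log {n s c : ℕ} (h : s ≤ n ^ c + c) :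
    s ≤ 2 ^ ((2 * c + 1) * (Nat.log 2 n + 1)) := by
  have h1 : n ^ c ≤ 2 ^ (c * (Nat.log 2 n + 1)) := by
    rw [mul_comm, pow_mul]
    exact Nat.pow_le_pow_left (Nat.lt_pow_succ_log_self one_lt_two n).le c
  have h2 : c ≤ 2 ^ (c * (Nat.log 2 n + 1)) :=
    Nat.lt_two_pow_self.le.trans (Nat.pow_le_pow_right two_pos (Nat.le_mul_of_pos_right _ (by omega)))
  calc s ≤ 2 ^ (c * (Nat.log 2 n + 1)) + 2 ^ (c * (Nat.log 2 n + 1)) := by omega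
    _ = 2 ^ (c * (Nat.log 2 n + 1) + 1) := by rw [pow_succ]; ring
    _ ≤ _ := Nat.pow_le_pow_right two_pos (by nlinarith [Nat.zero_le (c * (Nat.log 2 n + 1))])

theorem TC_zero_subset_NC_one (α : Type) [DecidableEq α] : TC 0 α ⊆ NC 1 α := by
  rintro L ⟨c, hc⟩
  refine mem_NC_one_iff.2 ⟨25 * (2 * c + 2) * c, fun n => ?_⟩
  obtain ⟨s, D, o, -, hs, hd, hx⟩ := hc n
  obtain ⟨F, hF, hFd⟩ := D.exists_formula_of_threshold _ (le_two_pow_mul_log hs) o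
  refine ⟨F, hFd.trans ?_, fun x => by rw [hF, hx]⟩
  rw [pow_zero, mul_one] at hd
  calc 25 * ((2 * c + 1) * (Nat.log 2 n + 1) + 1) * D.depth o
      ≤ 25 * ((2 * c + 2) * (Nat.log 2 n + 1)) * c := by
        refine Nat.mul_le_mul (Nat.mul_le_mul_left _ ?_) hd
        nlinarith
    _ = _ := by ring

/-- Composition of circuits: the inputs of the second circuit are wired to gates of the first. -/
theorem Circuit.exists_comp {ι ι' : Type} {s : ℕ} (D : Circuit ι s) (out : ι' → Fin s) (c : ℕ)
    (hout : ∀ i, D.depth (out i) ≤ c) : ∀ {s' : ℕ} (D' : Circuit ι' s'),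
      ∃ (D'' : Circuit ι (s + s')) , (∀ x j, D''.eval x (Fin.castAdd s' j) = D.eval x j) ∧
        (∀ j, D''.depth (Fin.castAdd s' j) = D.depth j) ∧
        (∀ x j, D''.eval x (Fin.natAdd s j) = D'.eval (fun i => D.eval x (out i)) j) ∧
        ∀ j, D''.depth (Fin.natAdd s j) ≤ c + 1 + D'.depth j
  | _, .nil => ⟨D, fun _ _ => rfl, fun _ => rfl, fun _ j => j.elim0, fun j => j.elim0⟩
  | _, .snoc (n := n) D' g => by
    obtain ⟨D'', h1, h2, h3, h4⟩ := D.exists_comp out c hout D'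
    have key : ∃ g' : Gate ι (s + n), (∀ x, g'.eval x (D''.eval x) =
        g.eval (fun i => D.eval x (out i)) (D'.eval fun i => D.eval x (out i))) ∧
        g'.depth D''.depth ≤ c + 1 + g.depth D'.depth := by
      have hsup (S : Finset (Fin n)) :
          (S.map (Fin.natAddEmb s)).sup D''.depth ≤ c + 1 + S.sup D'.depth := by
        rw [Finset.sup_map]
        exact Finset.sup_le fun j hj => (h4 j).trans (Nat.add_le_add_left (Finset.le_sup hj) _)
      cases g with
      | input i =>
        refine ⟨.and {Fin.castAdd n (out i)}, fun x => by simp [Gate.eval, h1], ?_⟩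
        simp only [Gate.depth, Finset.sup_singleton, h2]
        have := hout i
        omega
      | not j =>
        refine ⟨.not (Fin.natAdd s j), fun x => by simp [Gate.eval, h3], ?_⟩
        have := h4 j
        simp only [Gate.depth]
        omega
      | and S =>
        refine ⟨.and (S.map (Fin.natAddEmb s)), fun x => by simp [Gate.eval, h3], ?_⟩
        have := hsup S
        simp only [Gate.depth]
        omega
      | or S =>
        refine ⟨.or (S.map (Fin.natAddEmb s)), fun x => by simp [Gate.eval, h3], ?_⟩
        have := hsup S
        simp only [Gate.depth]
        omega
      | thr t S =>
        refine ⟨.thr t (S.map (Fin.natAddEmb s)), fun x => ?_, ?_⟩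
        · simp [Gate.eval, Finset.filter_map, h3]
        · have := hsup S
          simp only [Gate.depth]
          omega
    obtain ⟨g', hg, hgd⟩ := key
    refine ⟨D''.snoc g', fun x j => ?_, fun j => ?_, fun x j => ?_, fun j => ?_⟩
    · rw [← h1]
      exact Fin.snoc_castSucc (α := fun _ => Bool) _ _ (Fin.castAdd n j)
    · rw [← h2]
      exact Fin.snoc_castSucc (α := fun _ => ℕ) _ _ (Fin.castAdd n j)
    · induction j using Fin.lastCases with
      | cast j =>
        simp only [Circuit.eval, Fin.snoc_castSucc]
        rw [← h3]
        exact Fin.snoc_castSucc (α := fun _ => Bool) _ _ (Fin.natAdd s j)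
      | last =>
        simp only [Circuit.eval, Fin.snoc_last]
        rw [← hg]
        exact Fin.snoc_last (α := fun _ => Bool) _ _
    · induction j using Fin.lastCases with
      | cast j =>
        simp only [Circuit.depth, Fin.snoc_castSucc]
        refine le_trans (le_of_eq ?_) (h4 j)
        exact Fin.snoc_castSucc (α := fun _ => ℕ) _ _ (Fin.natAdd s j)
      | last =>
        simp only [Circuit.depth, Fin.snoc_last]
        refine le_trans (le_of_eq ?_) hgd
        exact Fin.snoc_last (α := fun _ => ℕ) _ _

theorem pow_pow_add_le (n c c' : ℕ) :
    n ^ c + c + ((n ^ c + c) ^ c' + c') ≤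
      2 ^ ((2 * c + 1) * (c' + 1) * (Nat.log 2 n + 1) + c' + 1) := by
  set k := (2 * c + 1) * (Nat.log 2 n + 1) with hk
  have h : n ^ c + c ≤ 2 ^ k := le_two_pow_mul_log le_rfl
  have h1 : (n ^ c + c) ^ c' ≤ 2 ^ (k * c') := by
    rw [pow_mul]
    exact Nat.pow_le_pow_left h c'
  have h2 : c' + 1 ≤ 2 ^ c' := Nat.lt_two_pow_self
  have hA : 1 ≤ 2 ^ k := Nat.one_le_two_pow
  have hB : 1 ≤ 2 ^ (k * c') := Nat.one_le_two_pow
  have e : 2 ^ ((2 * c + 1) * (c' + 1) * (Nat.log 2 n + 1) + c' + 1) =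
      2 ^ k * 2 ^ (k * c') * 2 ^ c' * 2 := by
    rw [← pow_add, ← pow_add, ← pow_succ, hk]
    congr 1
    ring
  rw [e]
  generalize 2 ^ k = a at *
  generalize 2 ^ (k * c') = b at *
  generalize 2 ^ c' = d at *
  have hab : a + b ≤ a * b + 1 := by nlinarith
  have hab' : 1 ≤ a * b := Nat.mul_pos hA hB
  nlinarith [Nat.mul_le_mul hab' h2]

/-- `TC^0` is closed under `AC^0` reductions. -/
theorem mem_TC_of_reduces {α β : Type} [DecidableEq α] [DecidableEq β] {L : Language α}
    {L' : Language β} (h : AC0Reduces L L') (hL' : L' ∈ TC 0 β) : L ∈ TC 0 α := by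
  obtain ⟨r, ⟨c, len, hr⟩, hrL⟩ := h
  obtain ⟨c', hc'⟩ := hL'
  set a := (2 * c + 1) * (c' + 1) + c' + 1 with ha
  refine ⟨2 * a + 2 ^ a + (c + 1 + c'), fun n => ?_⟩
  obtain ⟨hlen, s, D, out, -, hs, hd, hx⟩ := hr n
  obtain ⟨s', D', o, -, hs', hd', hx'⟩ := hc' (len n)
  obtain ⟨D'', -, -, heval, hdepth⟩ :=
    D.exists_comp (fun p : Fin (len n) × β => out p.1 p.2) c (fun p => hd p.1 p.2) D'
  refine ⟨s + s', D'', Fin.natAdd s o, D''.all_isTC, ?_, ?_, fun x => ?_⟩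
  · have h1 : len n ^ c' ≤ (n ^ c + c) ^ c' := Nat.pow_le_pow_left hlen c'
    have h2 := pow_pow_add_le n c c'
    have h3 : 2 ^ ((2 * c + 1) * (c' + 1) * (Nat.log 2 n + 1) + c' + 1) ≤
        2 ^ (a * (Nat.log 2 n + 1)) := Nat.pow_le_pow_right two_pos (by rw [ha]; nlinarith)
    have h4 := two_pow_mul_log_le_pow_add a n
    have h5 := pow_add_self_mono n (show 2 * a + 2 ^ a ≤ 2 * a + 2 ^ a + (c + 1 + c') by omega)
    linarith
  · rw [pow_zero, mul_one] at hd' ⊢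
    have := hdepth o
    have := Nat.zero_le (2 ^ a)
    linarith
  · obtain ⟨hl, hletter⟩ := hx x
    obtain ⟨y, hy⟩ : ∃ y : Fin (len n) → β, r (List.ofFn x) = List.ofFn y := by
      refine ⟨fun j => (r (List.ofFn x)).get (j.cast hl.symm), List.ext_get (by simpa using hl) ?_⟩
      intro i h1 h2
      simp
    have hin : (fun p : Fin (len n) × β => D.eval (oneHot x) (out p.1 p.2)) = oneHot y := by
      funext p
      rw [Bool.eq_iff_iff, hletter, hy]
      simp [oneHot]
    rw [heval, hin, hx', ← hy]
    exact (hrL _).symm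

theorem wordProblem_notMem_TC (h : TC 0 Bool ≠ NC 1 Bool) : wordProblem ∉ TC 0 Transp :=
  fun hT => h (Set.Subset.antisymm (TC_zero_subset_NC_one Bool) fun _ hL =>
    mem_TC_of_reduces (reduces_wordProblem hL) hT)

/-! ## Equivariance -/

theorem skip_mul {K R : ℕ} (res : Bool) (E : Matrix (Fin K) (Fin R) ℝ)
    (O : Matrix (Fin R) (Fin R) ℝ) : skip res (E * O) = skip res E * O := by
  cases res <;> simp [skip]

theorem mul_mul_transpose_of_mem_orthogonalGroup {K K' R : ℕ} (E : Matrix (Fin K) (Fin R) ℝ)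
    (E' : Matrix (Fin K') (Fin R) ℝ) {O : Matrix (Fin R) (Fin R) ℝ}
    (hO : O ∈ Matrix.orthogonalGroup (Fin R) ℝ) : E * O * (E' * O)ᵀ = E * E'ᵀ := by
  have h : O * Oᵀ = 1 := (Matrix.mem_orthogonalGroup_iff _ _).1 hO
  rw [Matrix.transpose_mul, Matrix.mul_assoc, ← Matrix.mul_assoc O, h, Matrix.one_mul]

theorem vecMul_dotProduct_vecMul_of_mem_orthogonalGroup {R : ℕ} (a b : Fin R → ℝ)
    {O : Matrix (Fin R) (Fin R) ℝ} (hO : O ∈ Matrix.orthogonalGroup (Fin R) ℝ) :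
    (a ᵥ* O) ⬝ᵥ (b ᵥ* O) = a ⬝ᵥ b := by
  have h : O * Oᵀ = 1 := (Matrix.mem_orthogonalGroup_iff _ _).1 hO
  rw [← Matrix.dotProduct_mulVec, ← Matrix.mulVec_transpose, Matrix.mulVec_mulVec, h,
    Matrix.one_mulVec]

namespace Layer

variable {C K R N : ℕ} (l : Layer C K R)

theorem attn_equivariant
    (hφ : ∀ E E', ∀ O ∈ Matrix.orthogonalGroup (Fin R) ℝ, l.φ (E * O) (E' * O) = l.φ E E')
    (X : Feat N C) (E : Pos N K R) (M : Mask N) (σ : Equiv.Perm (Fin N))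
    {O : Matrix (Fin R) (Fin R) ℝ} (hO : O ∈ Matrix.orthogonalGroup (Fin R) ℝ) (i j : Fin N) :
    l.attn (fun i => X (σ i)) (fun i => E (σ i) * O) (fun i j => M (σ i) (σ j)) i j =
      l.attn X E M (σ i) (σ j) := by
  have h (j : Fin N) : l.logit (fun i => X (σ i)) (fun i => E (σ i) * O) i j =
      l.logit X E (σ i) (σ j) := by
    simp only [logit, hφ _ _ O hO]
  simp only [attn, h, Mask.val]
  rw [Equiv.sum_comp σ fun j => (if M (σ i) j = true then (1 : ℝ) else 0) *
    Real.exp (l.logit X E (σ i) j)]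

theorem wyWeights_equivariant (q k : Fin K → ℝ) (E : Pos N K R) (M : Mask N)
    (σ : Equiv.Perm (Fin N)) {O : Matrix (Fin R) (Fin R) ℝ}
    (hO : O ∈ Matrix.orthogonalGroup (Fin R) ℝ) :
    wyWeights q k (fun i => E (σ i) * O) (fun i j => M (σ i) (σ j)) =
      (wyWeights q k E M).submatrix σ σ := by
  rw [wyWeights, wyWeights, ← Matrix.inv_submatrix_equiv]
  congr 1
  ext i j
  simp [Matrix.one_apply, ← Matrix.vecMul_vecMul, Mask.val,
    vecMul_dotProduct_vecMul_of_mem_orthogonalGroup _ _ hO]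

/-- Layers with explicit aggregation weights and an injection `φ` that depends on the Gram matrix
of the positional encodings are equivariant. -/
theorem equivariant_of_explicitAggregation
    (hφ : ∀ E E', ∀ O ∈ Matrix.orthogonalGroup (Fin R) ℝ, l.φ (E * O) (E' * O) = l.φ E E')
    (hB : l.ExplicitAggregation) : l.Equivariant := by
  intro N X E M σ O hO
  have hA := l.attn_equivariant hφ X E M σ hO
  have hB' (i j : Fin N) : l.B N (fun i => X (σ i)) (fun i => E (σ i) * O)
      (fun i j => M (σ i) (σ j)) i j = l.B N X E M (σ i) (σ j) := by
    rcases hB with h | h | ⟨q, k, h⟩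
    · simp [h]
    · rw [h, h, hA]
    · rw [h, h, wyWeights_equivariant q k E M σ hO, Matrix.submatrix_apply]
  have hf (i : Fin N) : l.fAttn (fun i => X (σ i)) (fun i => E (σ i) * O)
      (fun i j => M (σ i) (σ j)) i = l.fAttn X E M (σ i) := by
    simp only [fAttn, hA]
    rw [Equiv.sum_comp σ fun j => l.attn X E M (σ i) j • (l.WV *ᵥ X j)]
  have hg (i : Fin N) : l.gAttn (fun i => X (σ i)) (fun i => E (σ i) * O)
      (fun i j => M (σ i) (σ j)) i = l.gAttn X E M (σ i) * O := by
    simp only [gAttn, hB', skip_mul, Matrix.add_mul, Matrix.sum_mul, Matrix.smul_mul,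
      ← Matrix.mul_assoc]
    rw [Equiv.sum_comp σ fun j => l.B N X E M (σ i) j • (l.UV * E j * O)]
  constructor
  · funext i
    simp only [f, fFFN, hf]
  · funext i
    simp only [g, gFFN, hg, skip_mul, Matrix.add_mul, ← Matrix.mul_assoc]

end Layer

/-! ## The WY representation -/

section WY

variable {N m : ℕ} (v : Matrix (Fin N) (Fin m) ℝ)

/-- The strictly lower triangular part of the Gram matrix of the rows of `v`. -/
noncomputable def strictLowerGram : Matrix (Fin N) (Fin N) ℝ :=
  Matrix.of fun a b => if b < a then (v * vᵀ) a b else 0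

theorem det_one_add_strictLowerGram : (1 + strictLowerGram v).det = 1 := by
  rw [Matrix.det_of_isLowerTriangular]
  · simp [strictLowerGram]
  · intro i j hij
    have hij : i < j := hij
    simp [strictLowerGram, hij.ne, hij.not_gt]

theorem wy_recursion (i : Fin N) :
    ((1 + strictLowerGram v)⁻¹ * v) i =
      v i - ∑ j ∈ Finset.univ.filter fun j : Fin N => (j : ℕ) < i,
        (v j ⬝ᵥ v i) • ((1 + strictLowerGram v)⁻¹ * v) j := by
  have h : (1 + strictLowerGram v) * ((1 + strictLowerGram v)⁻¹ * v) = v := by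
    rw [← Matrix.mul_assoc, Matrix.mul_nonsing_inv _ (by
      rw [det_one_add_strictLowerGram]; exact isUnit_one), Matrix.one_mul]
  generalize (1 + strictLowerGram v)⁻¹ * v = W at h ⊢
  rw [eq_sub_iff_add_eq]
  conv_rhs => rw [← h]
  rw [Matrix.add_mul, Matrix.one_mul]
  funext c
  rw [Pi.add_apply, Matrix.add_apply, Finset.sum_apply, Finset.sum_filter,
    Matrix.mul_apply (M := strictLowerGram v)]
  congr 1
  refine Finset.sum_congr rfl fun j _ => ?_
  by_cases hj : j < i
  · simp [strictLowerGram, hj, Matrix.mul_apply, dotProduct, mul_comm (v i _)]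
  · simp [strictLowerGram, hj]

theorem prod_take_householder (k : ℕ) (hk : k ≤ N) :
    (((List.ofFn fun j => v j).take k).map fun x => 1 - vecMulVec x x).prod =
      1 - ∑ j ∈ Finset.univ.filter fun j : Fin N => (j : ℕ) < k,
        vecMulVec (((1 + strictLowerGram v)⁻¹ * v) j) (v j) := by
  induction k with
  | zero => simp
  | succ k ih =>
    have hfilter : (Finset.univ.filter fun j : Fin N => (j : ℕ) < k + 1) =
        insert ⟨k, hk⟩ (Finset.univ.filter fun j : Fin N => (j : ℕ) < k) := by
      ext j
      simp only [Finset.mem_filter, Finset.mem_univ, true_and, Finset.mem_insert, Fin.ext_iff]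
      omega
    have htake : (List.ofFn fun j => v j).take (k + 1) =
        (List.ofFn fun j => v j).take k ++ [v ⟨k, hk⟩] := by
      rw [List.take_add_one, List.getElem?_eq_getElem (by simpa using hk),
        List.getElem_ofFn]
      rfl
    rw [htake, List.map_append, List.prod_append, ih (by omega), hfilter,
      Finset.sum_insert (by simp), wy_recursion v ⟨k, hk⟩]
    generalize (1 + strictLowerGram v)⁻¹ * v = W
    simp only [List.map_cons, List.map_nil, List.prod_cons, List.prod_nil, mul_one]
    rw [Matrix.mul_sub, Matrix.mul_one, Matrix.sub_mul, Matrix.one_mul, Matrix.sub_vecMulVec,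
      Matrix.sum_mul]
    have : ∑ j ∈ Finset.univ.filter (fun j : Fin N => (j : ℕ) < k),
        vecMulVec (W j) (v j) * vecMulVec (v ⟨k, hk⟩) (v ⟨k, hk⟩) =
        vecMulVec (∑ j ∈ Finset.univ.filter (fun j : Fin N => (j : ℕ) < k),
          (v j ⬝ᵥ v ⟨k, hk⟩) • W j) (v ⟨k, hk⟩) := by
      ext a b
      simp [Matrix.vecMulVec_mul_vecMulVec, Matrix.sum_apply, vecMulVec_apply, Finset.sum_mul, mul_assoc]
    rw [this]
    abel

end WY

/-- The matrix with the rows `ξ_j`. -/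
noncomputable def xiMatrix (w : List Transp) : Matrix (Fin (w.length + 1)) (Fin 6) ℝ :=
  Matrix.of fun j => ξ (tokens w j)

theorem wyRepresentation_eq (w : List Transp) (i : Fin (w.length + 1)) :
    wyRepresentation w i = 1 - ∑ j ∈ Finset.Iic i,
      vecMulVec (((1 + strictLowerGram (xiMatrix w))⁻¹ * xiMatrix w) j) (ξ (tokens w j)) := rfl

theorem wyRepresentation_eq_householderProduct (w : List Transp) (i : Fin (w.length + 1)) :
    wyRepresentation w i = householderProduct w i := by
  have h := prod_take_householder (xiMatrix w) (i + 1) (by omega)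
  have hl : (List.ofFn fun j => xiMatrix w j) = (List.ofFn (tokens w)).map ξ := by
    rw [List.map_ofFn]; rfl
  rw [wyRepresentation_eq, householderProduct]
  rw [hl, ← List.map_take, List.map_map] at h
  refine Eq.trans ?_ h.symm
  congr 1
  refine Finset.sum_congr ?_ fun _ _ => rfl
  ext j
  simp only [Finset.mem_Iic, Finset.mem_filter, Finset.mem_univ, true_and, Fin.le_def]
  omega

/-- The permutation matrix of a permutation of five points, with a sixth fixed point. -/
def permBlock (σ : Equiv.Perm (Fin 5)) : Matrix (Fin 6) (Fin 6) ℝ :=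
  Matrix.of fun r c => Fin.lastCases (motive := fun _ => ℝ) (if r = Fin.last 5 then 1 else 0)
    (fun c => if r = (σ c).castSucc then 1 else 0) c

theorem permBlock_last (σ : Equiv.Perm (Fin 5)) (r : Fin 6) :
    permBlock σ r (Fin.last 5) = if r = Fin.last 5 then 1 else 0 := by
  simp only [permBlock, Matrix.of_apply, Fin.lastCases_last]

theorem permBlock_castSucc (σ : Equiv.Perm (Fin 5)) (r : Fin 6) (c : Fin 5) :
    permBlock σ r c.castSucc = if r = (σ c).castSucc then 1 else 0 := by
  simp only [permBlock, Matrix.of_apply, Fin.lastCases_castSucc]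

theorem permBlock_one : permBlock 1 = 1 := by
  ext r c
  induction c using Fin.lastCases with
  | last => rw [permBlock_last, Matrix.one_apply]
  | cast c => rw [permBlock_castSucc, Matrix.one_apply]; rfl

theorem permBlock_mul (σ τ : Equiv.Perm (Fin 5)) :
    permBlock (σ * τ) = permBlock σ * permBlock τ := by
  ext r c
  rw [Matrix.mul_apply]
  induction c using Fin.lastCases with
  | last =>
    rw [Finset.sum_eq_single (Fin.last 5) (fun b _ hb => by rw [permBlock_last, if_neg hb, mul_zero])
      (by simp), permBlock_last, permBlock_last, permBlock_last, if_pos rfl, mul_one]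
  | cast c =>
    rw [Finset.sum_eq_single (τ c).castSucc
      (fun b _ hb => by rw [permBlock_castSucc τ, if_neg hb, mul_zero])
      (by simp), permBlock_castSucc, permBlock_castSucc, permBlock_castSucc, if_pos rfl, mul_one]
    rfl

theorem permBlock_transp (t : Transp) :
    permBlock t.perm = 1 - vecMulVec (ξ (some t)) (ξ (some t)) := by
  have h := t.2.ne
  ext r c
  simp only [Matrix.sub_apply, Matrix.one_apply, vecMulVec_apply, ξ, Pi.sub_apply, Pi.single_apply]
  induction c using Fin.lastCases with
  | last =>
    rw [permBlock_last]
    simp only [(Fin.castSucc_ne_last _).symm, if_false, sub_zero, mul_zero]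
  | cast c =>
    rw [permBlock_castSucc, Transp.perm, Equiv.swap_apply_def]
    simp only [Fin.castSucc_inj]
    by_cases h1 : c = t.1.1 <;> by_cases h2 : c = t.1.2 <;>
      by_cases h3 : r = t.1.1.castSucc <;> by_cases h4 : r = t.1.2.castSucc <;>
      simp_all [Fin.castSucc_inj]

theorem householderProduct_eq_permBlock (w : List Transp) (i : Fin (w.length + 1)) :
    householderProduct w i = permBlock (reduce (w.take i)) := by
  have h : List.ofFn (tokens w) = none :: w.map some := by
    rw [List.ofFn_succ]
    simp only [tokens, Fin.cons_zero, Fin.cons_succ]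
    congr 1
    conv_rhs => rw [← List.ofFn_get w, List.map_ofFn]
    rfl
  rw [householderProduct, h, List.take_succ_cons, List.map_cons, List.prod_cons, ← List.map_take]
  simp only [ξ, Matrix.zero_vecMulVec, sub_zero, one_mul, List.map_map]
  induction w.take i with
  | nil => simp [reduce, permBlock_one]
  | cons t w ih =>
    rw [List.map_cons, List.prod_cons, ih]
    simp only [reduce, List.map_cons, List.prod_cons, permBlock_mul, permBlock_transp]
    rfl

theorem trace_permBlock (σ : Equiv.Perm (Fin 5)) :
    (permBlock σ).trace = (∑ a, if a = σ a then 1 else 0) + 1 := by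
  rw [Matrix.trace, Fin.sum_univ_castSucc]
  simp only [Matrix.diag_apply, permBlock_castSucc, permBlock_last, Fin.castSucc_inj, if_true]

theorem trace_permBlock_le {σ : Equiv.Perm (Fin 5)} (h : σ ≠ 1) : (permBlock σ).trace ≤ 5 := by
  obtain ⟨a, ha⟩ : ∃ a, σ a ≠ a := by
    by_contra! hc
    exact h (Equiv.ext hc)
  have : ∑ a, (if a = σ a then 1 else 0 : ℝ) ≤ ∑ b, if b = a then 0 else 1 :=
    Finset.sum_le_sum fun b _ => by
      by_cases hb : b = a
      · subst hb; simp [ha.symm]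
      · simp only [hb, if_false]; split_ifs <;> norm_num
  rw [trace_permBlock]
  have h4 : ∑ b, (if b = a then 0 else 1 : ℝ) = 4 := by
    have : ∀ b, (if b = a then 0 else 1 : ℝ) = 1 - if b = a then 1 else 0 := fun b => by
      split_ifs <;> norm_num
    simp only [this, Finset.sum_sub_distrib, Finset.sum_ite_eq', Finset.mem_univ, if_true]
    norm_num
  linarith

/-! ## Positional encodings in blocks -/

/-- Four `6 × 6` blocks as the rows of a positional encoding. -/
def pack : (Fin 4 → Matrix (Fin 6) (Fin 6) ℝ) →ₗ[ℝ] Matrix (Fin (4 * 6)) (Fin 6) ℝ where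
  toFun e := Matrix.of fun r c => e (finProdFinEquiv.symm r).1 (finProdFinEquiv.symm r).2 c
  map_add' _ _ := rfl
  map_smul' _ _ := rfl

theorem pack_apply (e : Fin 4 → Matrix (Fin 6) (Fin 6) ℝ) (a : Fin 4) (r c : Fin 6) :
    pack e (finProdFinEquiv (a, r)) c = e a r c := by
  change e (finProdFinEquiv.symm (finProdFinEquiv (a, r))).1
    (finProdFinEquiv.symm (finProdFinEquiv (a, r))).2 c = _
  rw [Equiv.symm_apply_apply]

/-- The matrix with the given `6 × 6` blocks. -/
def packMatrix (m : Matrix (Fin 4) (Fin 4) (Matrix (Fin 6) (Fin 6) ℝ)) :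
    Matrix (Fin (4 * 6)) (Fin (4 * 6)) ℝ :=
  Matrix.of fun r c => m (finProdFinEquiv.symm r).1 (finProdFinEquiv.symm c).1
    (finProdFinEquiv.symm r).2 (finProdFinEquiv.symm c).2

theorem packMatrix_mul_pack (m : Matrix (Fin 4) (Fin 4) (Matrix (Fin 6) (Fin 6) ℝ))
    (e : Fin 4 → Matrix (Fin 6) (Fin 6) ℝ) :
    packMatrix m * pack e = pack fun a => ∑ b, m a b * e b := by
  ext r c
  obtain ⟨⟨a, r⟩, rfl⟩ := finProdFinEquiv.surjective r
  rw [pack_apply, Matrix.sum_apply, Matrix.mul_apply,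
    ← Equiv.sum_comp finProdFinEquiv, Fintype.sum_prod_type]
  refine Finset.sum_congr rfl fun b _ => ?_
  rw [Matrix.mul_apply]
  refine Finset.sum_congr rfl fun k _ => ?_
  rw [pack_apply]
  simp [packMatrix]

/-! ## The transformer -/

/-- A layer with uniform attention and identity feedforward map, whose token features are updated
by attention with the value matrix `V`. -/
noncomputable def uniformLayer (V : Matrix (Fin (4 + 6)) (Fin (4 + 6)) ℝ)
    (B : ∀ N : ℕ, Feat N (4 + 6) → Pos N (4 * 6) 6 → Mask N → Matrix (Fin N) (Fin N) ℝ)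
    (U : Matrix (Fin 4) (Fin 4) (Matrix (Fin 6) (Fin 6) ℝ))
    (ψ : (Fin (4 + 6) → ℝ) → Matrix (Fin 4) (Fin 4) (Matrix (Fin 6) (Fin 6) ℝ)) :
    Layer (4 + 6) (4 * 6) 6 where
  WQ := 0
  WK := 0
  WV := V
  φ := fun _ _ => 0
  resFAttn := true
  hidden := 1
  W₁ := 0
  b₁ := 0
  act := .relu
  W₂ := 0
  b₂ := 0
  resFFFN := true
  B := B
  UV := packMatrix U
  resGAttn := true
  ψ := fun x => packMatrix (ψ x)
  resGFFN := false

/-- Token features: a constant, the indicator of the beginning of the sequence, the reciprocal of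
the number of tokens read, the output, and the vector `ξ`. -/
noncomputable def feature (t : Token) (u : ℝ) : Fin (4 + 6) → ℝ :=
  Fin.append ![1, if t = none then 1 else 0, u, 0] (ξ t)

/-- The vector `ξ` in the token features. -/
def featureXi (x : Fin (4 + 6) → ℝ) : Fin 6 → ℝ := fun a => x (Fin.natAdd 4 a)

theorem featureXi_feature (t : Token) (u : ℝ) : featureXi (feature t u) = ξ t := by
  funext a
  exact Fin.append_right _ _ a

theorem feature_castAdd (t : Token) (u : ℝ) (a : Fin 4) :
    feature t u (Fin.castAdd 6 a) = ![1, if t = none then 1 else 0, u, 0] a :=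
  Fin.append_left _ _ a

/-- The first unit vector. -/
def δ₀ : Fin 6 → ℝ := Pi.single 0 1

theorem δ₀_dotProduct_δ₀ : δ₀ ⬝ᵥ δ₀ = 1 := by simp [δ₀]

/-- The layer that computes the reciprocal position by attention to the first token, and writes
`ξ` into the positional encoding. -/
noncomputable def inputLayer : Layer (4 + 6) (4 * 6) 6 :=
  uniformLayer (Matrix.single (Fin.castAdd 6 2) (Fin.castAdd 6 1) 1) (fun _ _ _ _ => 0) 0
    fun x => !![1, 0, 0, 0; vecMulVec δ₀ (featureXi x), 0, 0, 0; 0, 0, 0, 0; 0, 0, 0, 0]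

/-- The layer that computes the vectors of the WY representation and the rank-one matrices
of its sum. -/
noncomputable def wyLayer : Layer (4 + 6) (4 * 6) 6 :=
  uniformLayer 0
    (fun _ _ E M => Layer.wyWeights (Pi.single (finProdFinEquiv (1, 0)) 1)
      (Pi.single (finProdFinEquiv (1, 0)) 1) E M)
    !![0, 0, 0, 0; 0, 0, 0, 0; 0, 1, 0, 0; 0, 0, 0, 0]
    fun x => !![1, 0, 0, 0; 0, 0, 0, 0; 0, 0, 0, 0; 0, 0, vecMulVec (featureXi x) δ₀, 0]

/-- The layer that accumulates the WY representation by attention, rescaled by the number of tokens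
read, and prepares the logits of the output layer. -/
noncomputable def sumLayer : Layer (4 + 6) (4 * 6) 6 :=
  uniformLayer 0 (fun _ X E M => (uniformLayer 0 (fun _ _ _ _ => 0) 0 0).attn X E M)
    !![0, 0, 0, 0; 0, 0, 0, 1; 0, 0, 0, 0; 0, 0, 0, 0]
    fun x =>
      let n := (x (Fin.castAdd 6 2))⁻¹
      !![1, 0, 0, 0; 1, Matrix.diagonal fun _ => -n, 0, 0;
        Matrix.diagonal fun _ => n * (2 - 11 / 6), Matrix.diagonal fun _ => -2 * n ^ 2, 0, 0;
        0, 0, 0, 0]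

/-- The layer that compares the accumulated product with the identity by attention to the first
token, and rounds the attention weight. -/
noncomputable def outputLayer : Layer (4 + 6) (4 * 6) 6 where
  WQ := 1
  WK := 1
  WV := Matrix.single (Fin.castAdd 6 3) (Fin.castAdd 6 1) 1
  φ := fun E E' => (∑ a, (E * E'ᵀ) (finProdFinEquiv (2, a)) (finProdFinEquiv (0, a))) •
    Matrix.single (Fin.castAdd 6 0) (Fin.castAdd 6 1) 1
  resFAttn := true
  hidden := 1
  W₁ := Matrix.single 0 (Fin.castAdd 6 3) 6
  b₁ := fun _ => -2
  act := .hardSigmoid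
  W₂ := Matrix.single (Fin.castAdd 6 3) 0 1
  b₂ := 0
  resFFFN := false
  B := fun _ _ _ _ => 0
  UV := 0
  resGAttn := true
  ψ := fun _ => 1
  resGFFN := false

/-- The transformer that solves the word problem. -/
noncomputable def wordTransformer : Transformer (4 + 6) (4 * 6) 6 where
  embed := fun t => feature t 0
  pos₀ := pack ![1, 0, 0, 0]
  layers := [inputLayer, wyLayer, sumLayer, outputLayer]
  out := Fin.castAdd 6 3

theorem wordTransformer_explicitAggregation :
    ∀ l ∈ wordTransformer.layers, l.ExplicitAggregation := by
  simp only [wordTransformer, List.mem_cons, List.not_mem_nil, or_false, forall_eq_or_imp, forall_eq]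
  exact ⟨.inl fun _ _ _ _ => rfl, .inr (.inr ⟨_, _, fun _ _ _ _ => rfl⟩),
    .inr (.inl fun _ _ _ _ => rfl), .inl fun _ _ _ _ => rfl⟩

theorem wordTransformer_equivariant : wordTransformer.Equivariant := by
  intro l hl
  refine l.equivariant_of_explicitAggregation ?_ (wordTransformer_explicitAggregation l hl)
  revert l
  simp only [wordTransformer, List.mem_cons, List.not_mem_nil, or_false, forall_eq_or_imp, forall_eq]
  refine ⟨fun _ _ _ _ => rfl, fun _ _ _ _ => rfl, fun _ _ _ _ => rfl, fun E E' O hO => ?_⟩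
  simp only [outputLayer, mul_mul_transpose_of_mem_orthogonalGroup E E' hO]

/-! ## The states of the transformer -/

theorem sum_causal_val {N : ℕ} (i : Fin N) : ∑ j, (causal N).val i j = (i : ℝ) + 1 := by
  simp only [Mask.val, causal, decide_eq_true_eq]
  rw [Finset.sum_boole]
  have : (Finset.univ.filter fun j : Fin N => j ≤ i) = Finset.Iic i := by ext; simp
  rw [this, Fin.card_Iic]
  push_cast
  rfl

theorem Layer.attn_of_logit_eq_zero {C K R N : ℕ} (l : Layer C K R) (X : Feat N C) (E : Pos N K R)
    (h : ∀ i j, l.logit X E i j = 0) (i j : Fin N) :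
    l.attn X E (causal N) i j = (causal N).val i j * ((i : ℝ) + 1)⁻¹ := by
  simp only [Layer.attn, h, Real.exp_zero, mul_one, sum_causal_val, div_eq_mul_inv]

theorem uniformLayer_logit (V B U ψ) {N : ℕ} (X : Feat N (4 + 6)) (E : Pos N (4 * 6) 6)
    (i j : Fin N) : (uniformLayer V B U ψ).logit X E i j = 0 := by
  simp [Layer.logit, uniformLayer]

theorem uniformLayer_mlp (V B U ψ) (x : Fin (4 + 6) → ℝ) : (uniformLayer V B U ψ).mlp x = 0 :=
  (add_zero _).trans (Matrix.zero_mulVec _)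

theorem uniformLayer_f (V B U ψ) {N : ℕ} (X : Feat N (4 + 6)) (E : Pos N (4 * 6) 6) (i : Fin N) :
    (uniformLayer V B U ψ).f X E (causal N) i =
      X i + ∑ j, ((causal N).val i j * ((i : ℝ) + 1)⁻¹) • (V *ᵥ X j) := by
  have h := (uniformLayer V B U ψ).attn_of_logit_eq_zero X E (uniformLayer_logit V B U ψ X E)
  simp only [Layer.f, Layer.fFFN, Layer.fAttn, uniformLayer_mlp, h]
  simp [uniformLayer, skip, add_comm]

section States

variable (w : List Transp)

theorem tokens_eq_none_iff (j : Fin (w.length + 1)) : tokens w j = none ↔ j = 0 := by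
  induction j using Fin.cases with
  | zero => simp [tokens]
  | succ j => simp [tokens, Fin.succ_ne_zero]

/-- The token features that the first layer computes. -/
noncomputable def hiddenFeature : Feat (w.length + 1) (4 + 6) :=
  fun i => feature (tokens w i) ((i : ℝ) + 1)⁻¹

theorem inputLayer_f (E : Pos (w.length + 1) (4 * 6) 6) :
    inputLayer.f (fun i => feature (tokens w i) 0) E (causal _) = hiddenFeature w := by
  funext i c
  rw [inputLayer, uniformLayer_f]
  simp only [Matrix.single_mulVec, one_mul, feature_castAdd, tokens_eq_none_iff, hiddenFeature]
  rw [Pi.add_apply, Finset.sum_apply]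
  simp only [Matrix.cons_val_one, Matrix.cons_val_zero, Pi.smul_apply, smul_eq_mul]
  rw [Finset.sum_eq_single 0 (fun j _ hj => by simp [hj, Function.update_apply]) (by simp)]
  have h0 : (causal (w.length + 1)).val i 0 = 1 := by simp [Mask.val, causal]
  rw [h0]
  induction c using Fin.addCases with
  | left a =>
    rw [feature_castAdd, feature_castAdd]
    fin_cases a <;> simp [Fin.ext_iff]
  | right a =>
    simp [feature, Function.update_apply, Fin.ext_iff]
    omega

theorem inputLayer_g :
    inputLayer.g (fun i => feature (tokens w i) 0) (fun _ => pack ![1, 0, 0, 0]) (causal _) =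
      fun i => pack ![1, vecMulVec δ₀ (ξ (tokens w i)), 0, 0] := by
  funext i
  simp only [Layer.g, Layer.gFFN, Layer.gAttn]
  simp only [inputLayer, uniformLayer, skip, featureXi_feature, Matrix.zero_apply, zero_smul,
    Finset.sum_const_zero, zero_add, if_true, packMatrix_mul_pack, Bool.false_eq_true, if_false,
    add_zero]
  congr 1
  funext a
  fin_cases a <;> simp [Fin.sum_univ_four]

theorem wyWeights_eq :
    Layer.wyWeights (Pi.single (finProdFinEquiv (1, 0)) 1) (Pi.single (finProdFinEquiv (1, 0)) 1)
      (fun i => pack ![1, vecMulVec δ₀ (ξ (tokens w i)), 0, 0]) (causal _) =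
      (1 + strictLowerGram (xiMatrix w))⁻¹ := by
  rw [Layer.wyWeights]
  congr 2
  ext i j
  have h (i : Fin (w.length + 1)) : (Pi.single (finProdFinEquiv (1, 0)) 1 ᵥ*
      pack ![1, vecMulVec δ₀ (ξ (tokens w i)), 0, 0] : Fin 6 → ℝ) = ξ (tokens w i) := by
    rw [Matrix.single_one_vecMul]
    funext c
    rw [Matrix.row_apply, pack_apply]
    simp [vecMulVec_apply, δ₀]
  simp only [h, strictLowerGram, Matrix.of_apply, Mask.val, causal, decide_eq_true_eq]
  rcases lt_trichotomy i j with hij | rfl | hij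
  · simp [hij.ne, hij.not_ge, hij.not_gt]
  · simp
  · simp [hij.ne', hij, hij.le, Matrix.mul_apply, dotProduct, xiMatrix]

/-- The vectors `w_j` of the WY representation. -/
noncomputable def wyVector : Matrix (Fin (w.length + 1)) (Fin 6) ℝ :=
  (1 + strictLowerGram (xiMatrix w))⁻¹ * xiMatrix w

theorem wyLayer_g :
    wyLayer.g (hiddenFeature w) (fun i => pack ![1, vecMulVec δ₀ (ξ (tokens w i)), 0, 0])
      (causal _) = fun i => pack ![1, 0, 0, vecMulVec (ξ (tokens w i)) (wyVector w i)] := by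
  funext i
  have hB : wyLayer.B _ (hiddenFeature w)
      (fun i => pack ![1, vecMulVec δ₀ (ξ (tokens w i)), 0, 0]) (causal _) =
      (1 + strictLowerGram (xiMatrix w))⁻¹ := wyWeights_eq w
  have hsum : ∑ j, (1 + strictLowerGram (xiMatrix w))⁻¹ i j • vecMulVec δ₀ (ξ (tokens w j)) =
      vecMulVec δ₀ (wyVector w i) := by
    ext a c
    simp only [Matrix.sum_apply, Matrix.smul_apply, vecMulVec_apply, smul_eq_mul, wyVector,
      Matrix.mul_apply, xiMatrix, Matrix.of_apply, Finset.mul_sum]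
    exact Finset.sum_congr rfl fun j _ => by ring
  simp only [Layer.g, Layer.gFFN, Layer.gAttn, hB]
  simp only [wyLayer, uniformLayer, skip, hiddenFeature, featureXi_feature, if_true,
    packMatrix_mul_pack, Bool.false_eq_true, if_false, add_zero, ← map_smul, ← map_sum, ← map_add]
  congr 1
  funext a
  fin_cases a <;>
    simp [Fin.sum_univ_four, Finset.sum_apply, hsum, Matrix.vecMulVec_mul_vecMulVec,
      δ₀_dotProduct_δ₀]

/-- The positional encodings that the third layer computes. -/
noncomputable def accumulated (i : Fin (w.length + 1)) : Matrix (Fin (4 * 6)) (Fin 6) ℝ :=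
  pack ![1, (wyRepresentation w i)ᵀ,
    ((i : ℝ) + 1) • ((2 : ℝ) • (wyRepresentation w i)ᵀ - (11 / 6 : ℝ) • (1 : Matrix (Fin 6) (Fin 6) ℝ)), 0]

theorem transpose_wyRepresentation (i : Fin (w.length + 1)) :
    (wyRepresentation w i)ᵀ =
      1 - ∑ j, (causal _).val i j • vecMulVec (ξ (tokens w j)) (wyVector w j) := by
  have h : (Finset.univ.filter fun j => j ≤ i) = Finset.Iic i := by ext; simp
  rw [wyRepresentation_eq, Matrix.transpose_sub, Matrix.transpose_one, Matrix.transpose_sum, ← h,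
    Finset.sum_filter]
  congr 1
  refine Finset.sum_congr rfl fun j _ => ?_
  by_cases hj : j ≤ i
  · simp [hj, Mask.val, causal, Matrix.transpose_vecMulVec, wyVector]
  · simp [hj, Mask.val, causal]

theorem sumLayer_g :
    sumLayer.g (hiddenFeature w)
      (fun i => pack ![1, 0, 0, vecMulVec (ξ (tokens w i)) (wyVector w i)]) (causal _) =
      accumulated w := by
  funext i
  have hB : sumLayer.B _ (hiddenFeature w)
      (fun i => pack ![1, 0, 0, vecMulVec (ξ (tokens w i)) (wyVector w i)]) (causal _) =
      Matrix.of fun i j => (causal _).val i j * ((i : ℝ) + 1)⁻¹ := by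
    ext i j
    exact Layer.attn_of_logit_eq_zero _ _ _ (uniformLayer_logit _ _ _ _ _ _) i j
  have hsum : ∑ j, ((causal (w.length + 1)).val i j * ((i : ℝ) + 1)⁻¹) •
      vecMulVec (ξ (tokens w j)) (wyVector w j) =
      ((i : ℝ) + 1)⁻¹ • (1 - (wyRepresentation w i)ᵀ) := by
    rw [transpose_wyRepresentation, sub_sub_cancel, Finset.smul_sum]
    exact Finset.sum_congr rfl fun j _ => by rw [smul_smul, mul_comm]
  have hi : (i : ℝ) + 1 ≠ 0 := by positivity
  simp only [Layer.g, Layer.gFFN, Layer.gAttn, hB]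
  simp only [sumLayer, uniformLayer, skip, hiddenFeature, feature_castAdd, if_true,
    packMatrix_mul_pack, Bool.false_eq_true, if_false, add_zero, ← map_smul, ← map_sum, ← map_add,
    accumulated]
  generalize (wyRepresentation w i)ᵀ = Q at hsum ⊢
  congr 1
  funext a
  fin_cases a
  · simp [Fin.sum_univ_four, Finset.sum_apply]
  · ext r c
    simp [Fin.sum_univ_four, Finset.sum_apply, hsum, Matrix.diagonal_mul]
    field_simp
    ring
  · ext r c
    simp [Fin.sum_univ_four, Finset.sum_apply, hsum, Matrix.diagonal_apply, Matrix.one_apply]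
    split_ifs <;> field_simp <;> ring
  · simp [Fin.sum_univ_four, Finset.sum_apply]

theorem uniformLayer_zero_f (B U ψ) (X : Feat (w.length + 1) (4 + 6))
    (E : Pos (w.length + 1) (4 * 6) 6) : (uniformLayer 0 B U ψ).f X E (causal _) = X := by
  funext i
  rw [uniformLayer_f]
  simp

theorem wyLayer_f (X : Feat (w.length + 1) (4 + 6)) (E : Pos (w.length + 1) (4 * 6) 6) :
    wyLayer.f X E (causal _) = X := uniformLayer_zero_f w _ _ _ X E

theorem sumLayer_f (X : Feat (w.length + 1) (4 + 6)) (E : Pos (w.length + 1) (4 * 6) 6) :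
    sumLayer.f X E (causal _) = X := uniformLayer_zero_f w _ _ _ X E

theorem foldl_layers :
    [inputLayer, wyLayer, sumLayer].foldl
      (fun s l => (l.f s.1 s.2 (causal _), l.g s.1 s.2 (causal _)))
      ((fun i => feature (tokens w i) 0, fun _ => pack ![1, 0, 0, 0]) :
        Feat (w.length + 1) (4 + 6) × Pos (w.length + 1) (4 * 6) 6) =
      (hiddenFeature w, accumulated w) := by
  rw [List.foldl_cons, List.foldl_cons, List.foldl_cons, List.foldl_nil]
  rw [inputLayer_f, inputLayer_g, wyLayer_f, wyLayer_g, sumLayer_f, sumLayer_g]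

theorem state_three : wordTransformer.state w 3 = (hiddenFeature w, accumulated w) :=
  foldl_layers w

theorem wordTransformer_accumulatesHouseholder : wordTransformer.AccumulatesHouseholder := by
  refine ⟨wordTransformer_explicitAggregation, 3, by simp [wordTransformer],
    fun r => finProdFinEquiv (1, r), fun w i => ⟨?_, wyRepresentation_eq_householderProduct w i⟩⟩
  rw [state_three]
  ext r c
  simp only [accumulated, Matrix.transpose_apply, Matrix.submatrix_apply, id, pack_apply]
  rfl

theorem outputLayer_logit (i j : Fin (w.length + 1)) :
    outputLayer.logit (hiddenFeature w) (accumulated w) i j =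
      if j = 0 then ((i : ℝ) + 1) * (2 * (wyRepresentation w i).trace - 11) else 0 := by
  have h : ∑ a, (accumulated w i * (accumulated w j)ᵀ) (finProdFinEquiv (2, a))
      (finProdFinEquiv (0, a)) = ((i : ℝ) + 1) * (2 * (wyRepresentation w i).trace - 11) := by
    simp only [Matrix.mul_apply, Matrix.transpose_apply, accumulated, pack_apply]
    simp [Matrix.one_apply, Matrix.trace, Finset.mul_sum, Finset.sum_sub_distrib, mul_sub]
    ring
  simp only [Layer.logit]
  simp only [outputLayer, h, Matrix.one_mulVec, hiddenFeature, Matrix.smul_mulVec,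
    Matrix.single_mulVec, feature_castAdd, tokens_eq_none_iff]
  change _ ⬝ᵥ (_ • Pi.single _ _) = _
  rw [dotProduct_smul, dotProduct_single, feature_castAdd]
  simp

theorem outputLayer_attn (i : Fin (w.length + 1)) :
    outputLayer.attn (hiddenFeature w) (accumulated w) (causal _) i 0 =
      Real.exp (((i : ℝ) + 1) * (2 * (wyRepresentation w i).trace - 11)) /
        (Real.exp (((i : ℝ) + 1) * (2 * (wyRepresentation w i).trace - 11)) + i) := by
  simp only [Layer.attn, outputLayer_logit]
  generalize ((i : ℝ) + 1) * (2 * (wyRepresentation w i).trace - 11) = s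
  have h0 : (causal (w.length + 1)).val i 0 = 1 := by simp [Mask.val, causal]
  have h (j : Fin (w.length + 1)) : (causal _).val i j * Real.exp (if j = 0 then s else 0) =
      (causal _).val i j + if j = 0 then Real.exp s - 1 else 0 := by
    by_cases hj : j = 0
    · subst hj; simp [h0]
    · simp [hj]
  simp only [h, Finset.sum_add_distrib, sum_causal_val, h0]
  simp
  ring_nf

theorem outputLayer_mlp (x : Fin (4 + 6) → ℝ) :
    outputLayer.mlp x (Fin.castAdd 6 3) =
      Activation.hardSigmoid.fn (6 * x (Fin.castAdd 6 3) - 2) := by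
  change ((Matrix.single (Fin.castAdd 6 3) 0 1 : Matrix (Fin (4 + 6)) (Fin 1) ℝ) *ᵥ
    (fun h : Fin 1 => Activation.hardSigmoid.fn
      (((Matrix.single 0 (Fin.castAdd 6 3) 6 : Matrix (Fin 1) (Fin (4 + 6)) ℝ) *ᵥ x) h +
        -2)) + 0) (Fin.castAdd 6 3) = _
  rw [Matrix.single_mulVec, Matrix.single_mulVec]
  simp [sub_eq_add_neg]

theorem predict_eq (i : Fin (w.length + 1)) :
    wordTransformer.predict w i = Activation.hardSigmoid.fn
      (6 * outputLayer.attn (hiddenFeature w) (accumulated w) (causal _) i 0 - 2) := by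
  have h4 : wordTransformer.state w 4 =
      (outputLayer.f (hiddenFeature w) (accumulated w) (causal _),
        outputLayer.g (hiddenFeature w) (accumulated w) (causal _)) := by
    have h3 := state_three w
    rw [Transformer.state] at h3 ⊢
    rw [List.take_succ_eq_append_getElem (by simp [wordTransformer]), List.foldl_append, h3]
    rfl
  have hX : outputLayer.fAttn (hiddenFeature w) (accumulated w) (causal _) i (Fin.castAdd 6 3) =
      outputLayer.attn (hiddenFeature w) (accumulated w) (causal _) i 0 := by
    rw [Layer.fAttn, Pi.add_apply, Finset.sum_apply]
    have hskip : skip outputLayer.resFAttn (hiddenFeature w i) (Fin.castAdd 6 3) = 0 :=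
      feature_castAdd (tokens w i) ((i : ℝ) + 1)⁻¹ 3
    have hWV (j : Fin (w.length + 1)) :
        (outputLayer.WV *ᵥ hiddenFeature w j) (Fin.castAdd 6 3) = if j = 0 then 1 else 0 := by
      simp only [outputLayer, hiddenFeature, Matrix.single_mulVec, feature_castAdd,
        tokens_eq_none_iff]
      simp
    simp only [hskip, Pi.smul_apply, hWV]
    simp
  change (wordTransformer.state w 4).1 i (Fin.castAdd 6 3) = _
  rw [h4, ← hX]
  exact (add_zero _).trans (outputLayer_mlp _)

theorem wordTransformer_solvesWordProblem : wordTransformer.SolvesWordProblem := by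
  intro w i
  rw [predict_eq, outputLayer_attn, wyRepresentation_eq_householderProduct,
    householderProduct_eq_permBlock]
  have hi : (0 : ℝ) ≤ i := by positivity
  split_ifs with h
  · have ht : (permBlock (reduce (w.take i))).trace = 6 := by
      rw [h, permBlock_one]; simp
    rw [ht]
    have he := Real.add_one_le_exp (((i : ℝ) + 1) * (2 * 6 - 11))
    generalize Real.exp (((i : ℝ) + 1) * (2 * 6 - 11)) = e at he ⊢
    have h1 : 1 ≤ 6 * (e / (e + i)) - 2 := by
      rw [le_sub_iff_add_le, ← mul_div_assoc, le_div_iff₀ (by linarith)]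
      linarith
    rw [Activation.fn, max_eq_right (by linarith), min_eq_left h1]
  · have ht := trace_permBlock_le h
    have hi1 : (1 : ℝ) ≤ i := by
      have : (i : ℕ) ≠ 0 := by
        intro h0
        rw [h0] at h
        exact h rfl
      exact_mod_cast Nat.one_le_iff_ne_zero.2 this
    set s := ((i : ℝ) + 1) * (2 * (permBlock (reduce (w.take i))).trace - 11) with hs
    have hs1 : s ≤ -(i + 1) := by nlinarith
    have he : Real.exp s * 3 ≤ 1 := by
      have h1 := Real.add_one_le_exp (-s)
      have h2 : Real.exp s * Real.exp (-s) = 1 := by rw [← Real.exp_add]; simp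
      nlinarith [Real.exp_pos s]
    have hpos := Real.exp_pos s
    generalize Real.exp s = e at he hpos ⊢
    have h1 : 6 * (e / (e + i)) - 2 ≤ 0 := by
      rw [sub_nonpos, ← mul_div_assoc, div_le_iff₀ (by linarith)]
      linarith
    rw [Activation.fn, max_eq_left h1, min_eq_right zero_le_one]

theorem wordTransformer_decision :
    (w ∈ wordProblem → wordTransformer.decision w = 1) ∧
      (w ∉ wordProblem → wordTransformer.decision w = 0) := by
  have h : wordTransformer.decision w = if reduce w = 1 then 1 else 0 := by
    rw [Transformer.decision, wordTransformer_solvesWordProblem w (Fin.last _)]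
    simp
  rw [h]
  exact ⟨fun hw => if_pos hw, fun hw => if_neg hw⟩

end States

end TAPE

open TAPE
theorem theorem1 :
    ∃ (C K : ℕ) (T : Transformer C K 6),
      T.Equivariant ∧
      T.SolvesWordProblem ∧
      T.AccumulatesHouseholder ∧
      NC1Complete wordProblem ∧
      (∀ (α : Type) [Fintype α] [DecidableEq α] (L : Language α), L ∈ NC 1 α →
        ∃ r : List α → List Transp, IsAC0Function r ∧
          ∀ x : List α, (x ∈ L → T.decision (r x) = 1) ∧ (x ∉ L → T.decision (r x) = 0)) ∧
      (TC 0 Bool ≠ NC 1 Bool → wordProblem ∉ TC 0 Transp) := by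
  refine ⟨_, _, wordTransformer, wordTransformer_equivariant, wordTransformer_solvesWordProblem,
    wordTransformer_accumulatesHouseholder, wordProblem_complete, fun α _ _ L hL => ?_,
    wordProblem_notMem_TC⟩
  obtain ⟨r, hr, hL⟩ := reduces_wordProblem hL
  refine ⟨r, hr, fun x => ?_⟩
  rw [hL x]
  exact wordTransformer_decision (r x)
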